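/- Let $d\ge 1$ be an integer. A density operator on a finite-dimensional Hilbert space $\mathcal H$ is a positive semidefinite operator of trace $1$; it is a pure state if moreover $\mathrm{tr}(\rho^2)=1$. Write $\mathbf D(\mathcal H)$ and $\mathbf P(\mathcal H)$ for the sets of density operators and of pure states, $\|M\|_{\mathrm{tr}}=\frac12\mathrm{tr}\sqrt{MM^\dagger}$, and $\mathrm{SEP}(\mathcal H_A:\mathcal H_B)=\mathrm{conv}\{\phi\otimes\psi:\phi\in\mathbf P(\mathcal H_A),\psi\in\mathbf P(\mathcal H_B)\}$. A linear completely positive trace-preserving map $\Lambda$ from operators on $\mathbb C^D$ to operators on $\mathbb C^d\otimes\mathbb C^d$ is an $(\epsilon,\delta)$-disentangler if (1) for every $\rho\in\mathbf D(\mathbb C^D)$, $\min_{\sigma\in \mathrm{SEP}(\mathbb C^d:\mathbb C^d)}\|\Lambda(\rho)-\sigma\|_{\mathrm{tr}}\le\epsilon$, and (2) for every $\sigma\in \mathrm{SEP}(\mathbb C^d:\mathbb C^d)$, $\min_{\rho\in\mathbf D(\mathbb C^D)}\|\Lambda(\rho)-\sigma\|_{\mathrm{tr}}\le\delta$. It is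 an $(\epsilon,\delta)$-strong disentangler if (2) holds and, for every finite-dimensional $\mathcal H_R$ and every $\rho\in\mathbf D(\mathbb C^D\otimes\mathcal H_R)$, $\min_{\sigma\in \mathrm{SEP}(\mathbb C^d:\mathbb C^d\otimes\mathcal H_R)}\|(\Lambda\otimes\mathrm{id}_R)(\rho)-\sigma\|_{\mathrm{tr}}\le\epsilon$. A finite set $I\subseteq\mathbf P(\mathbb C^d)$ is an $\epsilon$-net if for every $\phi\in\mathbf P(\mathbb C^d)$ there is $\hat\phi\in I$ with $\|\hat\phi-\phi\|_{\mathrm{tr}}\le\epsilon$. **Theorem.** (a) Let $\delta\ge0$, let $I$ be a finite $\sqrt\delta$-net of $\mathbf P(\mathbb C^d)$, let $\{|e_{\hat\phi}\rangle\}_{\hat\phi\in I}$ be any orthonormal basis of $\mathbb C^{|I|}$, put $D=|I|\,d$ and identify $\mathbb C^D$ with $\mathbb C^{|I|}\otimes\mathbb C^d$. Then $$\Lambda(\rho)=\sum_{\hat\phi\in I}\hat\phi\otimes\mathrm{tr}_1\big[(|e_{\hat\phi}\rangle\langle e_{\hat\phi}|\otimes\mathbb I_d)\rho\big]$$ is linear,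 completely positive and trace preserving, and it is both a $(0,\delta)$-disentangler and a $(0,\delta)$-strong disentangler. (b) If $d\ge2$ and $0<\delta\le1$, then a $\sqrt\delta$-net of $\mathbf P(\mathbb C^d)$ of minimum size exists, and for every such net $I$ the dimension $D=|I|\,d$ satisfies $$\log_2D\le(d-1)\log_2\frac1\delta+\log_2(5d\ln d)+\log_2d .$$ -/

import Mathlib

open scoped Kronecker MatrixOrder ComplexOrder

/-- Density operators on the finite-dimensional Hilbert space with orthonormal basis indexed by `n`:
positive semidefinite operators of trace one. -/
def densityOps (n : Type*) [Fintype n] : Set (Matrix n n ℂ) :=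
  {ρ | ρ.PosSemidef ∧ ρ.trace = 1}

/-- Pure states: density operators `ρ` with `tr (ρ ^ 2) = 1`. -/
def pureStates (n : Type*) [Fintype n] : Set (Matrix n n ℂ) :=
  {ρ | ρ ∈ densityOps n ∧ (ρ * ρ).trace = 1}

/-- Separable states of a bipartite system: the convex hull of the products of pure states. -/
def sepStates (m n : Type*) [Fintype m] [Fintype n] : Set (Matrix (m × n) (m × n) ℂ) :=
  convexHull ℝ {σ | ∃ φ ∈ pureStates m, ∃ ψ ∈ pureStates n, σ = φ ⊗ₖ ψ}

/-- The trace-distance norm `‖M‖_tr = (1/2) tr √(M M†)`. -/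
noncomputable def trNorm {n : Type*} [Fintype n] [DecidableEq n] (M : Matrix n n ℂ) : ℝ :=
  (1 / 2) * (CFC.sqrt (M * M.conjTranspose)).trace.re

/-- `Λ ⊗ id_R` for a linear map `Λ` on operators, where `R` is the system with index type `r`. -/
def tensorId {m n : Type*} (r : Type*) (Λ : Matrix m m ℂ →ₗ[ℂ] Matrix n n ℂ) :
    Matrix (m × r) (m × r) ℂ →ₗ[ℂ] Matrix (n × r) (n × r) ℂ where
  toFun X := Matrix.of fun p q => Λ (Matrix.of fun a b => X (a, p.2) (b, q.2)) p.1 q.1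
  map_add' X Y := by
    ext p q
    exact congrFun (congrFun (map_add Λ (Matrix.of fun a b => X (a, p.2) (b, q.2))
      (Matrix.of fun a b => Y (a, p.2) (b, q.2))) p.1) q.1
  map_smul' c X := by
    ext p q
    exact congrFun (congrFun (map_smul Λ c (Matrix.of fun a b => X (a, p.2) (b, q.2))) p.1) q.1

/-- Linear, completely positive and trace-preserving maps. -/
structure IsCPTP {m n : Type*} [Fintype m] [Fintype n]
    (Λ : Matrix m m ℂ →ₗ[ℂ] Matrix n n ℂ) : Prop where
  completelyPositive : ∀ (k : ℕ) (X : Matrix (m × Fin k) (m × Fin k) ℂ),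
    X.PosSemidef → (tensorId (Fin k) Λ X).PosSemidef
  tracePreserving : ∀ X : Matrix m m ℂ, (Λ X).trace = X.trace

/-- `(ε, δ)`-disentanglers. The minimum over a compact set of states is at most a given number
exactly if some state in the set achieves that number as an upper bound. -/
structure IsDisentangler {D d : ℕ} (ε δ : ℝ)
    (Λ : Matrix (Fin D) (Fin D) ℂ →ₗ[ℂ] Matrix (Fin d × Fin d) (Fin d × Fin d) ℂ) : Prop where
  cptp : IsCPTP Λ
  nearSeparable : ∀ ρ ∈ densityOps (Fin D),
    ∃ σ ∈ sepStates (Fin d) (Fin d), trNorm (Λ ρ - σ) ≤ ε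
  approximatesSeparable : ∀ σ ∈ sepStates (Fin d) (Fin d),
    ∃ ρ ∈ densityOps (Fin D), trNorm (Λ ρ - σ) ≤ δ

/-- `(ε, δ)`-strong disentanglers. The environment ranges over all `ℂ^k`, and the state
`(Λ ⊗ id_R) ρ` is read on `ℂ^d ⊗ (ℂ^d ⊗ ℂ^k)` through the associativity of the product. -/
structure IsStrongDisentangler {D d : ℕ} (ε δ : ℝ)
    (Λ : Matrix (Fin D) (Fin D) ℂ →ₗ[ℂ] Matrix (Fin d × Fin d) (Fin d × Fin d) ℂ) : Prop where
  cptp : IsCPTP Λ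
  nearSeparable : ∀ k : ℕ, ∀ ρ ∈ densityOps (Fin D × Fin k),
    ∃ σ ∈ sepStates (Fin d) (Fin d × Fin k),
      trNorm (Matrix.reindex (Equiv.prodAssoc (Fin d) (Fin d) (Fin k))
        (Equiv.prodAssoc (Fin d) (Fin d) (Fin k)) (tensorId (Fin k) Λ ρ) - σ) ≤ ε
  approximatesSeparable : ∀ σ ∈ sepStates (Fin d) (Fin d),
    ∃ ρ ∈ densityOps (Fin D), trNorm (Λ ρ - σ) ≤ δ

/-- `I` is a finite `ε`-net of the pure states of `ℂ^d` with respect to the trace distance. -/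
def IsPureNet {d : ℕ} (ε : ℝ) (I : Finset (Matrix (Fin d) (Fin d) ℂ)) : Prop :=
  (∀ φ ∈ I, φ ∈ pureStates (Fin d)) ∧
    ∀ φ ∈ pureStates (Fin d), ∃ φ' ∈ I, trNorm (φ' - φ) ≤ ε

/-- `I` is an `ε`-net of the pure states of `ℂ^d` of the minimum size. -/
def IsMinPureNet {d : ℕ} (ε : ℝ) (I : Finset (Matrix (Fin d) (Fin d) ℂ)) : Prop :=
  IsPureNet ε I ∧ ∀ J : Finset (Matrix (Fin d) (Fin d) ℂ), IsPureNet ε J → I.card ≤ J.card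

/-- The partial trace over the first tensor factor. -/
def ptrace₁ {m n : Type*} [Fintype m] (X : Matrix (m × n) (m × n) ℂ) : Matrix n n ℂ :=
  Matrix.of fun b c => ∑ a, X (a, b) (a, c)

theorem ptrace₁_add {m n : Type*} [Fintype m] (X Y : Matrix (m × n) (m × n) ℂ) :
    ptrace₁ (X + Y) = ptrace₁ X + ptrace₁ Y := by
  ext b c
  simp [ptrace₁, Finset.sum_add_distrib]

theorem ptrace₁_smul {m n : Type*} [Fintype m] (r : ℂ) (X : Matrix (m × n) (m × n) ℂ) :
    ptrace₁ (r • X) = r • ptrace₁ X := by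
  ext b c
  simp [ptrace₁, Finset.mul_sum]

/-- The rank-one operator `|v⟩⟨v|`. -/
def ketbra {n : Type*} (v : EuclideanSpace ℂ n) : Matrix n n ℂ :=
  Matrix.of fun a b => v a * star (v b)

/-- The measure-and-prepare map `ρ ↦ ∑_{φ ∈ I} φ ⊗ tr₁[(|e_φ⟩⟨e_φ| ⊗ 1) ρ]` on `ℂ^D`,
`D = |I| d`, where `ℂ^D` is identified with `ℂ^|I| ⊗ ℂ^d` through the standard bases. -/
noncomputable def netChannel {d : ℕ} (I : Finset (Matrix (Fin d) (Fin d) ℂ))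
    (e : OrthonormalBasis I ℂ (EuclideanSpace ℂ (Fin I.card))) :
    Matrix (Fin (I.card * d)) (Fin (I.card * d)) ℂ →ₗ[ℂ]
      Matrix (Fin d × Fin d) (Fin d × Fin d) ℂ where
  toFun ρ := ∑ φ : I, φ.1 ⊗ₖ ptrace₁ ((ketbra (e φ) ⊗ₖ (1 : Matrix (Fin d) (Fin d) ℂ)) *
    Matrix.reindex finProdFinEquiv.symm finProdFinEquiv.symm ρ)
  map_add' X Y := by
    rw [← Finset.sum_add_distrib]
    refine Finset.sum_congr rfl fun φ _ => ?_
    rw [← Matrix.kronecker_add, ← ptrace₁_add, ← Matrix.mul_add]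
    rfl
  map_smul' r X := by
    rw [RingHom.id_apply, Finset.smul_sum]
    refine Finset.sum_congr rfl fun φ _ => ?_
    rw [← Matrix.kronecker_smul, ← ptrace₁_smul, ← Matrix.mul_smul]
    rfl

/-! ### Rank-one operators and spectral decompositions. -/

section Ketbra

variable {n ι : Type*}

/-! Part (a). Every output is `∑ φ ⊗ N_φ` with `N_φ` positive semidefinite and of total trace one,
hence exactly separable; an environment only enlarges the second factor, so the strong version is
the same computation. For the approximation, the key is a one-sided operator inequality: each pure
`φ` satisfies `φ ≤ κ + P` with `κ` a mixture of net states, `P ≥ 0` and `tr P = δ`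
(`exists_convexHull_add_posSemidef`). If it failed, Hahn–Banach would give a separating functional,
which is a positive observable; but the net state closest to its top eigenvector has overlap at
least `1 - δ` with that eigenvector, because the squared trace distance of pure states is one minus
their overlap. This is why a `√δ`-net yields error `δ`. The inequality is stable under tensoring and
convex combination. Between states it reads `Λ ρ - σ = Q - P` with `P, Q ≥ 0` of trace `δ`, which
bounds the trace distance by `δ` (`trNorm_sub_le`).

Part (b). Write `d = n + 1`. Under the normalised Gaussian measure on `ℂ^d`, a cap of trace radius
`r` around a line has measure at least `r ^ (2 * n)` (`exists_isProbabilityMeasure_cap`). Choose `N`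
caps of radius `(1 - η)√δ`, each catching at least its average share of what is left, then complete
them by a maximal packing of caps of radius `η√δ` in the small remainder (`exists_finset_cover`).
Taking `η = 1 / (8 n)` and `N` of order `n log n / δ ^ n` gives a net of size at most `5 d ln d
(1/δ)^(d-1)`; the cases `n < 3` need the packing alone (`exists_covering_parameters`). -/

theorem ketbra_eq_vecMulVec (v : EuclideanSpace ℂ n) :
    ketbra v = Matrix.vecMulVec v (star (v : n → ℂ)) := rfl

theorem posSemidef_ketbra [Finite n] (v : EuclideanSpace ℂ n) : (ketbra v).PosSemidef :=
  Matrix.posSemidef_vecMulVec_self_star _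

variable [Fintype n]

theorem trace_ketbra (v : EuclideanSpace ℂ n) : (ketbra v).trace = ((‖v‖ ^ 2 : ℝ) : ℂ) := by
  rw [EuclideanSpace.norm_sq_eq]
  simp [Matrix.trace, ketbra, Complex.mul_conj, Complex.normSq_eq_norm_sq]

theorem trace_ketbra_mul (v : EuclideanSpace ℂ n) (A : Matrix n n ℂ) :
    (ketbra v * A).trace = star (v : n → ℂ) ⬝ᵥ A.mulVec v := by
  rw [ketbra_eq_vecMulVec, Matrix.trace_mul_comm, Matrix.mul_vecMulVec, Matrix.trace_vecMulVec,
    dotProduct_comm]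

theorem mul_ketbra_apply (v : EuclideanSpace ℂ n) (A : Matrix n n ℂ) (a c : n) :
    (A * ketbra v) a c = A.mulVec v a * star (v c) := by
  rw [ketbra_eq_vecMulVec, Matrix.mul_vecMulVec]
  rfl

theorem ketbra_mul_ketbra (u v : EuclideanSpace ℂ n) :
    ketbra u * ketbra v = inner ℂ u v • Matrix.vecMulVec u (star (v : n → ℂ)) := by
  rw [ketbra_eq_vecMulVec, ketbra_eq_vecMulVec, Matrix.vecMulVec_mul_vecMulVec,
    EuclideanSpace.inner_eq_star_dotProduct, dotProduct_comm, Matrix.vecMulVec_smul]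

theorem ketbra_mul_mul_ketbra (v : EuclideanSpace ℂ n) (A : Matrix n n ℂ) :
    ketbra v * A * ketbra v = (ketbra v * A).trace • ketbra v := by
  rw [trace_ketbra_mul, Matrix.mul_assoc]
  simp only [ketbra_eq_vecMulVec]
  rw [Matrix.mul_vecMulVec, Matrix.vecMulVec_mul_vecMulVec, Matrix.vecMulVec_smul]

theorem trace_ketbra_mul_ketbra (u v : EuclideanSpace ℂ n) :
    (ketbra u * ketbra v).trace = ((‖inner ℂ u v‖ ^ 2 : ℝ) : ℂ) := by
  rw [ketbra_mul_ketbra, Matrix.trace_smul, Matrix.trace_vecMulVec,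
    ← EuclideanSpace.inner_eq_star_dotProduct, smul_eq_mul, ← inner_conj_symm v u,
    Complex.mul_conj, Complex.normSq_eq_norm_sq]

theorem ketbra_mem_pureStates {v : EuclideanSpace ℂ n} (hv : ‖v‖ = 1) :
    ketbra v ∈ pureStates n := by
  refine ⟨⟨posSemidef_ketbra v, by simp [trace_ketbra, hv]⟩, ?_⟩
  rw [trace_ketbra_mul_ketbra, inner_self_eq_norm_sq_to_K, hv]
  simp

theorem ketbra_mul_ketbra_of_orthonormal [DecidableEq ι] {v : ι → EuclideanSpace ℂ n}
    (hv : Orthonormal ℂ v) (i j : ι) :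
    ketbra (v i) * ketbra (v j) = if i = j then ketbra (v i) else 0 := by
  rw [ketbra_mul_ketbra, orthonormal_iff_ite.1 hv]
  split_ifs with h
  · rw [h, one_smul]
    rfl
  · rw [zero_smul]

theorem sum_smul_ketbra_mul_self [Fintype ι] {v : ι → EuclideanSpace ℂ n}
    (hv : Orthonormal ℂ v) (α : ι → ℂ) :
    (∑ i, α i • ketbra (v i)) * ∑ i, α i • ketbra (v i) = ∑ i, (α i * α i) • ketbra (v i) := by
  classical
  simp_rw [Finset.sum_mul, Finset.mul_sum, Matrix.smul_mul, Matrix.mul_smul,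
    ketbra_mul_ketbra_of_orthonormal hv, smul_ite, smul_zero, Finset.sum_ite_eq, Finset.mem_univ,
    if_true, smul_smul]

theorem posSemidef_sum_smul_ketbra [Fintype ι] (v : ι → EuclideanSpace ℂ n) {α : ι → ℝ}
    (hα : ∀ i, 0 ≤ α i) : (∑ i, (α i : ℂ) • ketbra (v i)).PosSemidef :=
  Matrix.posSemidef_sum _ fun i _ => (posSemidef_ketbra _).smul (by exact_mod_cast hα i)

theorem trace_ketbra_mul_re_nonneg (v : EuclideanSpace ℂ n) {A : Matrix n n ℂ}
    (hA : A.PosSemidef) : 0 ≤ (ketbra v * A).trace.re := by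
  rw [trace_ketbra_mul]
  exact (Complex.nonneg_iff.1 (hA.dotProduct_mulVec_nonneg v)).1

variable [DecidableEq n]

theorem sum_ketbra [Fintype ι] (b : OrthonormalBasis ι ℂ (EuclideanSpace ℂ n)) :
    ∑ i, ketbra (b i) = 1 := by
  ext a c
  have h := b.sum_inner_mul_inner (EuclideanSpace.single a 1) (EuclideanSpace.single c 1)
  simp only [EuclideanSpace.inner_single_left, EuclideanSpace.inner_single_right] at h
  rw [Matrix.sum_apply, Matrix.one_apply]
  simpa [ketbra, Pi.single_apply, eq_comm] using h

theorem Matrix.IsHermitian.eq_sum_ketbra {A : Matrix n n ℂ} (hA : A.IsHermitian) :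
    A = ∑ i, (hA.eigenvalues i : ℂ) • ketbra (hA.eigenvectorBasis i) := by
  conv_lhs => rw [← Matrix.mul_one A, ← sum_ketbra hA.eigenvectorBasis, Matrix.mul_sum]
  refine Finset.sum_congr rfl fun i _ => ?_
  ext a c
  rw [mul_ketbra_apply, hA.mulVec_eigenvectorBasis]
  simp [ketbra, mul_assoc]

end Ketbra

/-! ### Trace distance and the structure of pure states. -/

section TraceNorm

variable {n : Type*} [Fintype n] [DecidableEq n]

/-- Uniqueness of the positive square root: exhibiting one `S` suffices to compute the norm. -/
theorem trNorm_eq_of_mul_self {M S : Matrix n n ℂ} (hM : M.IsHermitian) (hS : S.PosSemidef)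
    (h : S * S = M * M) : trNorm M = (1 / 2) * S.trace.re := by
  have : CFC.sqrt (M * M.conjTranspose) = S := by
    rw [hM.eq]
    exact CFC.sqrt_unique h hS.nonneg
  rw [trNorm, this]

theorem trNorm_eq_sum_abs_eigenvalues {M : Matrix n n ℂ} (hM : M.IsHermitian) :
    trNorm M = (1 / 2) * ∑ i, |hM.eigenvalues i| := by
  have hb := hM.eigenvectorBasis.orthonormal
  rw [trNorm_eq_of_mul_self hM
    (posSemidef_sum_smul_ketbra (hM.eigenvectorBasis) fun i => abs_nonneg (hM.eigenvalues i))]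
  · congr 1
    simp [Matrix.trace_sum, Matrix.trace_smul, trace_ketbra, hb.1]
  · rw [sum_smul_ketbra_mul_self hb]
    conv_rhs => rw [hM.eq_sum_ketbra, sum_smul_ketbra_mul_self hb]
    refine Finset.sum_congr rfl fun i _ => ?_
    rw [← Complex.ofReal_mul, ← Complex.ofReal_mul, abs_mul_abs_self]

theorem sum_trace_ketbra_mul {ι : Type*} [Fintype ι]
    (b : OrthonormalBasis ι ℂ (EuclideanSpace ℂ n)) (A : Matrix n n ℂ) :
    ∑ i, (ketbra (b i) * A).trace.re = A.trace.re := by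
  rw [← Complex.re_sum, ← Matrix.trace_sum, ← Matrix.sum_mul, sum_ketbra, Matrix.one_mul]

/-- In an eigenbasis of `A - B` each eigenvalue is a difference of two nonnegative expectations, so
its absolute value is at most their sum. -/
theorem trNorm_sub_le {A B : Matrix n n ℂ} (hA : A.PosSemidef) (hB : B.PosSemidef) :
    trNorm (A - B) ≤ (A.trace.re + B.trace.re) / 2 := by
  have hM := hA.isHermitian.sub hB.isHermitian
  rw [trNorm_eq_sum_abs_eigenvalues hM]
  have : ∑ i, |hM.eigenvalues i| ≤ A.trace.re + B.trace.re := by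
    rw [← sum_trace_ketbra_mul hM.eigenvectorBasis A, ← sum_trace_ketbra_mul hM.eigenvectorBasis B,
      ← Finset.sum_add_distrib]
    refine Finset.sum_le_sum fun i _ => ?_
    have h1 : hM.eigenvalues i = (ketbra (hM.eigenvectorBasis i) * A).trace.re
        - (ketbra (hM.eigenvectorBasis i) * B).trace.re := by
      rw [hM.eigenvalues_eq, ← trace_ketbra_mul, Matrix.mul_sub, Matrix.trace_sub]
      rfl
    have h2 := trace_ketbra_mul_re_nonneg (hM.eigenvectorBasis i) hA
    have h3 := trace_ketbra_mul_re_nonneg (hM.eigenvectorBasis i) hB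
    rw [h1, abs_le]
    constructor <;> linarith
  linarith

theorem exists_eq_ketbra_of_mem_pureStates {ρ : Matrix n n ℂ} (hρ : ρ ∈ pureStates n) :
    ∃ v : EuclideanSpace ℂ n, ‖v‖ = 1 ∧ ρ = ketbra v := by
  obtain ⟨⟨hpsd, htr⟩, hsq⟩ := hρ
  have hH := hpsd.isHermitian
  have hb := hH.eigenvectorBasis.orthonormal
  have h1 : ∑ i, hH.eigenvalues i = 1 := by
    have := hH.trace_eq_sum_eigenvalues
    rw [htr] at this
    exact Complex.ofReal_injective (by simpa using this.symm)
  have h2 : ∑ i, hH.eigenvalues i * hH.eigenvalues i = 1 := by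
    have e : (ρ * ρ).trace = ∑ i, (hH.eigenvalues i : ℂ) * hH.eigenvalues i := by
      conv_lhs => rw [hH.eq_sum_ketbra, sum_smul_ketbra_mul_self hb]
      simp [Matrix.trace_sum, Matrix.trace_smul, trace_ketbra, hb.1]
    rw [hsq] at e
    exact_mod_cast e.symm
  have h0 := hpsd.eigenvalues_nonneg
  have hle : ∀ i, hH.eigenvalues i ≤ 1 := fun i =>
    h1 ▸ Finset.single_le_sum (fun j _ => h0 j) (Finset.mem_univ i)
  -- The eigenvalues lie in `[0, 1]` and have the same sum as their squares, so each of the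
  -- nonnegative terms `λ (1 - λ)` vanishes and every eigenvalue is 0 or 1.
  have hz : ∀ i, hH.eigenvalues i * (1 - hH.eigenvalues i) = 0 := by
    have hs : ∑ i, hH.eigenvalues i * (1 - hH.eigenvalues i) = 0 := by
      simp_rw [mul_sub, mul_one, Finset.sum_sub_distrib, h1, h2, sub_self]
    intro i
    exact (Finset.sum_eq_zero_iff_of_nonneg
      fun j _ => mul_nonneg (h0 j) (sub_nonneg.2 (hle j))).1 hs i (Finset.mem_univ i)
  obtain ⟨j, hj⟩ : ∃ j, hH.eigenvalues j ≠ 0 := by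
    by_contra! h
    simp [h] at h1
  have hj1 : hH.eigenvalues j = 1 := by
    have := (mul_eq_zero.1 (hz j)).resolve_left hj
    linarith
  have hoth : ∀ i, i ≠ j → hH.eigenvalues i = 0 := by
    intro i hi
    have hs := Finset.add_sum_erase Finset.univ hH.eigenvalues (Finset.mem_univ j)
    rw [h1, hj1] at hs
    have hs0 : ∑ x ∈ Finset.univ.erase j, hH.eigenvalues x = 0 := by linarith
    exact (Finset.sum_eq_zero_iff_of_nonneg fun x _ => h0 x).1 hs0 i (by simp [hi])
  refine ⟨hH.eigenvectorBasis j, hb.1 j, ?_⟩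
  conv_lhs => rw [hH.eq_sum_ketbra]
  rw [Finset.sum_eq_single j (fun i _ hi => by simp [hoth i hi]) (by simp), hj1]
  simp

/-- The trace distance of pure states. -/
theorem trNorm_ketbra_sub_ketbra {u v : EuclideanSpace ℂ n} (hu : ‖u‖ = 1) (hv : ‖v‖ = 1) :
    trNorm (ketbra u - ketbra v) = √(1 - ‖inner ℂ u v‖ ^ 2) := by
  set t : ℝ := ‖inner ℂ u v‖ ^ 2 with ht
  have hH := (posSemidef_ketbra u).isHermitian.sub (posSemidef_ketbra v).isHermitian
  have huu : ketbra u * ketbra u = ketbra u := by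
    rw [ketbra_mul_ketbra, inner_self_eq_norm_sq_to_K, hu]
    simp [ketbra_eq_vecMulVec]
  have hvv : ketbra v * ketbra v = ketbra v := by
    rw [ketbra_mul_ketbra, inner_self_eq_norm_sq_to_K, hv]
    simp [ketbra_eq_vecMulVec]
  have huvu : ketbra u * ketbra v * ketbra u = (t : ℂ) • ketbra u := by
    rw [ketbra_mul_mul_ketbra, trace_ketbra_mul_ketbra]
  have hvuv : ketbra v * ketbra u * ketbra v = (t : ℂ) • ketbra v := by
    rw [ketbra_mul_mul_ketbra, Matrix.trace_mul_comm, trace_ketbra_mul_ketbra]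
  have htr : ((ketbra u - ketbra v) * (ketbra u - ketbra v)).trace = ((2 * (1 - t) : ℝ) : ℂ) := by
    simp only [Matrix.sub_mul, Matrix.mul_sub, huu, hvv, Matrix.trace_sub]
    rw [Matrix.trace_mul_comm (ketbra v), trace_ketbra_mul_ketbra, trace_ketbra, trace_ketbra,
      hu, hv, ← ht]
    push_cast
    ring
  -- For the difference `M`, the relation `M³ = (1 - t) M` shows that `M² / √(1 - t)` is the
  -- positive square root of `M²` when `t < 1`; no diagonalisation is needed.
  have hcube : (ketbra u - ketbra v) * (ketbra u - ketbra v) * (ketbra u - ketbra v)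
      = ((1 - t : ℝ) : ℂ) • (ketbra u - ketbra v) := by
    simp only [Matrix.sub_mul, Matrix.mul_sub, huu, hvv, huvu, hvuv]
    simp only [Matrix.mul_assoc, huu, hvv]
    push_cast
    simp only [sub_smul, smul_sub, one_smul]
    abel
  have ht1 : 0 ≤ 1 - t := by
    have h := norm_inner_le_norm (𝕜 := ℂ) u v
    rw [hu, hv, one_mul] at h
    have := pow_le_one₀ (n := 2) (norm_nonneg _) h
    linarith
  have hsq : ((ketbra u - ketbra v) * (ketbra u - ketbra v)).PosSemidef := by
    have := Matrix.posSemidef_conjTranspose_mul_self (ketbra u - ketbra v)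
    rwa [hH.eq] at this
  rcases ht1.eq_or_lt with h0 | hpos
  · have hM : ketbra u - ketbra v = 0 := by
      rw [← Matrix.trace_conjTranspose_mul_self_eq_zero_iff, hH.eq, htr, ← h0]
      simp
    rw [hM, ← h0, trNorm_eq_of_mul_self (S := 0) Matrix.isHermitian_zero Matrix.PosSemidef.zero
      rfl]
    simp
  · set s := √(1 - t) with hs
    have hs0 : 0 < s := Real.sqrt_pos.2 hpos
    have hss : s * s = 1 - t := Real.mul_self_sqrt ht1
    rw [trNorm_eq_of_mul_self hH (hsq.smul (a := ((s⁻¹ : ℝ) : ℂ))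
      (by exact_mod_cast (inv_pos.2 hs0).le))]
    · rw [Matrix.trace_smul, htr, smul_eq_mul, ← Complex.ofReal_mul, Complex.ofReal_re, ← hss]
      field_simp
    · rw [Matrix.smul_mul, Matrix.mul_smul, ← Matrix.mul_assoc, hcube, Matrix.smul_mul, smul_smul,
        smul_smul, ← Complex.ofReal_mul, ← Complex.ofReal_mul, ← hss]
      have : s⁻¹ * s⁻¹ * (s * s) = 1 := by field_simp
      rw [this]
      simp

end TraceNorm

/-! ### Convexity, compactness and linear functionals on matrices. -/

section HahnBanach

variable {n : Type*}

theorem convex_posSemidef : Convex ℝ {P : Matrix n n ℂ | P.PosSemidef} := by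
  intro P hP Q hQ a b ha hb _
  exact (hP.smul ha).add (hQ.smul hb)

variable [Fintype n]

theorem isClosed_posSemidef : IsClosed {P : Matrix n n ℂ | P.PosSemidef} := by
  have : {P : Matrix n n ℂ | P.PosSemidef} = {P | P.conjTranspose = P} ∩
      ⋂ x : n → ℂ, {P | 0 ≤ star x ⬝ᵥ P.mulVec x} := by
    ext P
    simp only [Matrix.posSemidef_iff_dotProduct_mulVec, Set.mem_inter_iff, Set.mem_iInter,
      Set.mem_ofPred_eq]
    rfl
  rw [this]
  refine (isClosed_eq (by fun_prop) continuous_id).inter (isClosed_iInter fun x => ?_)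
  exact isClosed_Ici.preimage (continuous_const.dotProduct
    (continuous_id.matrix_mulVec continuous_const))

theorem convex_posSemidef_trace_eq (δ : ℂ) :
    Convex ℝ {P : Matrix n n ℂ | P.PosSemidef ∧ P.trace = δ} := by
  intro P hP Q hQ a b ha hb hab
  refine ⟨convex_posSemidef hP.1 hQ.1 ha hb hab, ?_⟩
  rw [Matrix.trace_add, Matrix.trace_smul, Matrix.trace_smul, hP.2, hQ.2, ← add_smul, hab, one_smul]

variable [DecidableEq n]

/-- Entries of a unit rank-one projector have modulus at most one, so the spectral decomposition
bounds every entry by the sum of the eigenvalues. This supplies the boundedness behind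
`isCompact_posSemidef_trace_eq`. -/
theorem Matrix.PosSemidef.norm_apply_le_trace {P : Matrix n n ℂ} (hP : P.PosSemidef) (a c : n) :
    ‖P a c‖ ≤ P.trace.re := by
  have hH := hP.isHermitian
  have hb := hH.eigenvectorBasis.orthonormal
  have htr : P.trace.re = ∑ i, hH.eigenvalues i := by
    rw [hH.trace_eq_sum_eigenvalues]
    simp
  have hle : ∀ i, ∀ a, ‖hH.eigenvectorBasis i a‖ ≤ 1 := fun i a =>
    (PiLp.norm_apply_le _ a).trans (hb.1 i).le
  rw [htr]
  conv_lhs => rw [hH.eq_sum_ketbra, Matrix.sum_apply]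
  refine (norm_sum_le _ _).trans (Finset.sum_le_sum fun i _ => ?_)
  rw [Matrix.smul_apply, smul_eq_mul, norm_mul, Complex.norm_real, Real.norm_eq_abs,
    abs_of_nonneg (hP.eigenvalues_nonneg i)]
  refine mul_le_of_le_one_right (hP.eigenvalues_nonneg i) ?_
  change ‖hH.eigenvectorBasis i a * star (hH.eigenvectorBasis i c)‖ ≤ 1
  rw [norm_mul, norm_star]
  exact mul_le_one₀ (hle i a) (norm_nonneg _) (hle i c)

theorem isCompact_posSemidef_trace_eq (δ : ℝ) :
    IsCompact {P : Matrix n n ℂ | P.PosSemidef ∧ P.trace = δ} := by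
  have hK : IsCompact (Set.pi Set.univ fun _ : n => Set.pi Set.univ fun _ : n =>
      Metric.closedBall (0 : ℂ) δ) :=
    isCompact_univ_pi fun _ => isCompact_univ_pi fun _ => isCompact_closedBall _ _
  refine IsCompact.of_isClosed_subset hK
    (isClosed_posSemidef.inter (isClosed_eq continuous_id.matrix_trace continuous_const)) ?_
  rintro P ⟨hP, htr⟩ a - c -
  have := hP.norm_apply_le_trace a c
  rw [htr, Complex.ofReal_re] at this
  simpa using this

/-- A linear functional acts on Hermitian matrices as a diagonal observable in some basis. -/
theorem exists_orthonormalBasis_functional (f : Matrix n n ℂ →ₗ[ℂ] ℂ) :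
    ∃ (b : OrthonormalBasis n ℂ (EuclideanSpace ℂ n)) (l : n → ℝ), ∀ A : Matrix n n ℂ,
      A.IsHermitian → (f A).re = ∑ i, l i * (ketbra (b i) * A).trace.re := by
  let V : Matrix n n ℂ := Matrix.of fun c a => f (Matrix.single a c 1)
  have hV : ∀ A, f A = (V * A).trace := by
    intro A
    conv_lhs => rw [Matrix.matrix_eq_sum_single A]
    simp only [map_sum]
    simp only [Matrix.trace, Matrix.diag_apply, Matrix.mul_apply, V, Matrix.of_apply]
    rw [Finset.sum_comm]
    refine Finset.sum_congr rfl fun c _ => Finset.sum_congr rfl fun a _ => ?_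
    have : Matrix.single a c (A a c) = A a c • Matrix.single a c (1 : ℂ) := by
      rw [Matrix.smul_single, smul_eq_mul, mul_one]
    rw [this, map_smul, smul_eq_mul, mul_comm]
  -- Against Hermitian `A`, the real part of `tr (V A)` sees only the Hermitian part of `V`, which
  -- can be diagonalised.
  have hW : ((2⁻¹ : ℝ) • (V + V.conjTranspose)).IsHermitian := by
    have := (Matrix.isHermitian_add_transpose_self V)
    rw [Matrix.IsHermitian, Matrix.conjTranspose_smul, this.eq, star_trivial]
  refine ⟨hW.eigenvectorBasis, hW.eigenvalues, fun A hA => ?_⟩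
  have h1 : (V.conjTranspose * A).trace.re = (V * A).trace.re := by
    rw [← hA.eq, ← Matrix.conjTranspose_mul, Matrix.trace_conjTranspose, Matrix.trace_mul_comm,
      hA.eq]
    simp
  have h2 : (f A).re = (((2⁻¹ : ℝ) • (V + V.conjTranspose)) * A).trace.re := by
    rw [hV, Matrix.smul_mul, Matrix.trace_smul, Complex.smul_re, Matrix.add_mul, Matrix.trace_add,
      Complex.add_re, h1, smul_eq_mul]
    ring
  rw [h2]
  conv_lhs => rw [hW.eq_sum_ketbra]
  simp only [Matrix.sum_mul, Matrix.trace_sum, Matrix.smul_mul, Matrix.trace_smul, smul_eq_mul,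
    Complex.re_sum, Complex.re_ofReal_mul]

instance : LocallyConvexSpace ℝ (Matrix n n ℂ) :=
  inferInstanceAs (LocallyConvexSpace ℝ (n → n → ℂ))

end HahnBanach

/-! ### Domination of a pure state by a mixture over the net. -/

section Net

open scoped Pointwise

variable {d : ℕ}

theorem one_sub_le_of_trNorm_le {u v : EuclideanSpace ℂ (Fin d)} (hu : ‖u‖ = 1) (hv : ‖v‖ = 1)
    {δ : ℝ} (hδ : 0 ≤ δ) (h : trNorm (ketbra u - ketbra v) ≤ √δ) :
    1 - δ ≤ (ketbra v * ketbra u).trace.re := by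
  rw [trNorm_ketbra_sub_ketbra hu hv] at h
  have := (Real.sqrt_le_sqrt_iff hδ).1 h
  rw [Matrix.trace_mul_comm, trace_ketbra_mul_ketbra, Complex.ofReal_re]
  linarith

/-- A pure state is dominated by a mixture of net states up to a positive error of trace `δ`. -/
theorem exists_convexHull_add_posSemidef {δ : ℝ} (hδ : 0 ≤ δ)
    {I : Finset (Matrix (Fin d) (Fin d) ℂ)} (hI : IsPureNet (√δ) I)
    {φ : Matrix (Fin d) (Fin d) ℂ} (hφ : φ ∈ pureStates (Fin d)) :
    ∃ κ ∈ convexHull ℝ (I : Set (Matrix (Fin d) (Fin d) ℂ)), ∃ P : Matrix (Fin d) (Fin d) ℂ,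
      P.PosSemidef ∧ P.trace = δ ∧ (κ + P - φ).PosSemidef := by
  by_contra! hcon
  have hconv : Convex ℝ {A : Matrix (Fin d) (Fin d) ℂ | (A - φ).PosSemidef} := by
    intro A hA B hB a b ha hb hab
    have := convex_posSemidef hA hB ha hb hab
    have e : a • A + b • B - φ = a • (A - φ) + b • (B - φ) := by
      rw [smul_sub, smul_sub, sub_add_sub_comm, ← add_smul, hab, one_smul]
    simpa only [Set.mem_ofPred_eq, e] using this
  have hclosed : IsClosed {A : Matrix (Fin d) (Fin d) ℂ | (A - φ).PosSemidef} :=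
    isClosed_posSemidef.preimage (continuous_id.sub continuous_const)
  have hdisj : Disjoint (convexHull ℝ (I : Set (Matrix (Fin d) (Fin d) ℂ))
      + {P : Matrix (Fin d) (Fin d) ℂ | P.PosSemidef ∧ P.trace = δ})
      {A : Matrix (Fin d) (Fin d) ℂ | (A - φ).PosSemidef} := by
    refine Set.disjoint_left.2 ?_
    rintro _ ⟨κ, hκ, P, ⟨hP, htr⟩, rfl⟩
    exact hcon κ hκ P hP htr
  obtain ⟨f, u, v, hu, huv, hv⟩ := RCLike.geometric_hahn_banach_compact_closed (𝕜 := ℂ)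
    ((convex_convexHull ℝ _).add (convex_posSemidef_trace_eq _))
    ((I.finite_toSet.isCompact_convexHull ℝ).add (isCompact_posSemidef_trace_eq δ))
    hconv hclosed hdisj
  -- `Re f` is bounded below on `φ` plus the positive cone; a negative value on the cone would,
  -- after scaling, violate that bound.
  have hpos : ∀ P : Matrix (Fin d) (Fin d) ℂ, P.PosSemidef → 0 ≤ (f P).re := by
    intro P hP
    by_contra! hneg
    obtain ⟨t, ht⟩ := exists_nat_gt (((f φ).re - v) / -(f P).re)
    have h := hv (φ + t • P) (by
      change (φ + t • P - φ).PosSemidef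
      rw [add_sub_cancel_left, ← Nat.cast_smul_eq_nsmul ℝ]
      exact hP.smul (Nat.cast_nonneg t))
    rw [div_lt_iff₀ (by linarith)] at ht
    rw [map_add, map_nsmul] at h
    simp at h
    linarith
  obtain ⟨b, l, hl⟩ := exists_orthonormalBasis_functional (f : Matrix (Fin d) (Fin d) ℂ →ₗ[ℂ] ℂ)
  have hb := b.orthonormal
  have hfb : ∀ j, (f (ketbra (b j))).re = l j := by
    intro j
    refine (hl _ (posSemidef_ketbra _).isHermitian).trans ?_
    rw [Finset.sum_eq_single j]
    · simp [ketbra_mul_ketbra_of_orthonormal hb, trace_ketbra, hb.1]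
    · intro i _ hij
      simp [ketbra_mul_ketbra_of_orthonormal hb, hij]
    · simp
  have hl0 : ∀ j, 0 ≤ l j := fun j => hfb j ▸ hpos _ (posSemidef_ketbra _)
  have hne : Nonempty (Fin d) := by
    by_contra hempty
    rw [not_nonempty_iff] at hempty
    have := hφ.1.2
    simp [Matrix.trace] at this
  -- The top eigenvector `b j` of the observable is compared with a net state near it.
  obtain ⟨j, hj⟩ := Finite.exists_max l
  obtain ⟨ψ, hψI, hψ⟩ := hI.2 _ (ketbra_mem_pureStates (hb.1 j))
  obtain ⟨x, hx, rfl⟩ := exists_eq_ketbra_of_mem_pureStates (hI.1 ψ hψI)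
  have h1 : l j * (1 - δ) ≤ (f (ketbra x)).re := by
    refine le_trans ?_ (hl _ (posSemidef_ketbra x).isHermitian).ge
    refine (mul_le_mul_of_nonneg_left (one_sub_le_of_trNorm_le hx (hb.1 j) hδ hψ)
      (hl0 j)).trans ?_
    exact Finset.single_le_sum (f := fun i => l i * (ketbra (b i) * ketbra x).trace.re)
      (fun i _ => mul_nonneg (hl0 i) (trace_ketbra_mul_re_nonneg _ (posSemidef_ketbra x)))
      (Finset.mem_univ j)
  have h2 : (f φ).re ≤ l j := by
    refine (hl _ hφ.1.1.isHermitian).le.trans ?_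
    calc ∑ i, l i * (ketbra (b i) * φ).trace.re
        ≤ ∑ i, l j * (ketbra (b i) * φ).trace.re := Finset.sum_le_sum fun i _ =>
          mul_le_mul_of_nonneg_right (hj i) (trace_ketbra_mul_re_nonneg _ hφ.1.1)
      _ = l j := by
          rw [← Finset.mul_sum, sum_trace_ketbra_mul, hφ.1.2]
          simp
  -- The point `ketbra x + δ • ketbra (b j)` of the compact set has value at least `(1 - δ) l j + δ
  -- l j = l j`, hence at least the value at `φ`: this contradicts strict separation.
  have h3 := hu (ketbra x + (δ : ℂ) • ketbra (b j)) (Set.add_mem_add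
    (subset_convexHull ℝ _ hψI) ⟨(posSemidef_ketbra _).smul (by exact_mod_cast hδ), by
      simp [Matrix.trace_smul, trace_ketbra, hb.1]⟩)
  have h4 := hv φ (by
    change (φ - φ).PosSemidef
    rw [sub_self]
    exact Matrix.PosSemidef.zero)
  rw [map_add, map_smul] at h3
  simp [hfb] at h3
  simp at h4
  linarith

end Net

/-! ### The unnormalised state of the second factor after a measurement outcome on the first. -/

section Compression

variable {m n : Type*} [Fintype m]

/-- The partial expectation `(⟨e| ⊗ 1) X (|e⟩ ⊗ 1)`. -/
def compress (e : EuclideanSpace ℂ m) (X : Matrix (m × n) (m × n) ℂ) : Matrix n n ℂ :=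
  Matrix.of fun b c => ∑ a, ∑ a', star (e a') * X (a', b) (a, c) * e a

theorem ptrace₁_ketbra_mul [Fintype n] [DecidableEq n] (e : EuclideanSpace ℂ m)
    (X : Matrix (m × n) (m × n) ℂ) :
    ptrace₁ ((ketbra e ⊗ₖ (1 : Matrix n n ℂ)) * X) = compress e X := by
  ext b c
  simp only [ptrace₁, compress, Matrix.of_apply, Matrix.mul_apply, Fintype.sum_prod_type,
    Matrix.kroneckerMap_apply, Matrix.one_apply, mul_ite, mul_one, mul_zero, ite_mul, zero_mul,
    Finset.sum_ite_eq, Finset.mem_univ, if_true, ketbra]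
  refine Finset.sum_congr rfl fun a _ => Finset.sum_congr rfl fun a' _ => ?_
  ring

theorem compress_eq_conjTranspose_mul_mul [Fintype n] [DecidableEq n] (e : EuclideanSpace ℂ m)
    (X : Matrix (m × n) (m × n) ℂ) :
    compress e X = (Matrix.of fun (p : m × n) c => if p.2 = c then e p.1 else 0).conjTranspose * X *
      Matrix.of fun (p : m × n) c => if p.2 = c then e p.1 else 0 := by
  ext b c
  simp [compress, Matrix.mul_apply, Fintype.sum_prod_type, apply_ite, Finset.sum_mul]

theorem posSemidef_compress [Fintype n] (e : EuclideanSpace ℂ m)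
    {X : Matrix (m × n) (m × n) ℂ} (hX : X.PosSemidef) : (compress e X).PosSemidef := by
  classical
  rw [compress_eq_conjTranspose_mul_mul]
  exact hX.conjTranspose_mul_mul_same _

theorem sum_trace_compress [Fintype n] {ι : Type*} [Fintype ι]
    (b : OrthonormalBasis ι ℂ (EuclideanSpace ℂ m)) (X : Matrix (m × n) (m × n) ℂ) :
    ∑ i, (compress (b i) X).trace = X.trace := by
  classical
  have h : ∀ a a', ∑ i, star (b i a') * b i a = if a = a' then 1 else 0 := by
    intro a a'
    have := congrFun (congrFun (sum_ketbra b) a) a'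
    rw [Matrix.sum_apply, Matrix.one_apply] at this
    rw [← this]
    exact Finset.sum_congr rfl fun i _ => mul_comm _ _
  simp only [compress, Matrix.trace, Matrix.diag_apply, Matrix.of_apply]
  rw [Finset.sum_comm, Fintype.sum_prod_type_right]
  refine Finset.sum_congr rfl fun c _ => ?_
  rw [Finset.sum_comm]
  refine Finset.sum_congr rfl fun a _ => ?_
  rw [Finset.sum_comm]
  simp_rw [mul_right_comm _ (X _ _), ← Finset.sum_mul, h, ite_mul, one_mul, zero_mul,
    Finset.sum_ite_eq, Finset.mem_univ, if_true]

theorem compress_add (e : EuclideanSpace ℂ m) (X Y : Matrix (m × n) (m × n) ℂ) :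
    compress e (X + Y) = compress e X + compress e Y := by
  ext b c
  simp [compress, mul_add, add_mul, Finset.sum_add_distrib]

theorem compress_smul (e : EuclideanSpace ℂ m) (r : ℝ) (X : Matrix (m × n) (m × n) ℂ) :
    compress e (r • X) = r • compress e X := by
  ext b c
  simp only [compress, Matrix.of_apply, Matrix.smul_apply, Finset.smul_sum, Complex.real_smul]
  exact Finset.sum_congr rfl fun a _ => Finset.sum_congr rfl fun a' _ => by ring

theorem compress_sum {ι : Type*} (e : EuclideanSpace ℂ m) (s : Finset ι)
    (X : ι → Matrix (m × n) (m × n) ℂ) :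
    compress e (∑ i ∈ s, X i) = ∑ i ∈ s, compress e (X i) := by
  classical
  induction s using Finset.induction_on with
  | empty =>
    ext b c
    simp [compress]
  | insert i s hi ih => rw [Finset.sum_insert hi, Finset.sum_insert hi, compress_add, ih]

theorem compress_ketbra_kronecker (e f : EuclideanSpace ℂ m) (ψ : Matrix n n ℂ) :
    compress e (ketbra f ⊗ₖ ψ) = ((‖inner ℂ e f‖ ^ 2 : ℝ) : ℂ) • ψ := by
  rw [← trace_ketbra_mul_ketbra]
  ext b c
  simp only [compress, Matrix.of_apply, Matrix.smul_apply, smul_eq_mul, Matrix.trace,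
    Matrix.diag_apply, Matrix.mul_apply, Matrix.kroneckerMap_apply, ketbra, Finset.sum_mul]
  refine Finset.sum_congr rfl fun a _ => Finset.sum_congr rfl fun a' _ => ?_
  ring

end Compression

/-! ### Separable states. -/

section Separable

variable {m n : Type*} [Fintype m] [Fintype n]

theorem kronecker_mem_densityOps {φ : Matrix m m ℂ} {ψ : Matrix n n ℂ} (hφ : φ ∈ densityOps m)
    (hψ : ψ ∈ densityOps n) : φ ⊗ₖ ψ ∈ densityOps (m × n) := by
  classical
  refine ⟨hφ.1.kronecker hψ.1, ?_⟩
  rw [Matrix.trace_kronecker, hφ.2, hψ.2, one_mul]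

theorem sepStates_subset_densityOps : sepStates m n ⊆ densityOps (m × n) := by
  refine convexHull_min ?_ (convex_posSemidef_trace_eq 1)
  rintro _ ⟨φ, hφ, ψ, hψ, rfl⟩
  exact kronecker_mem_densityOps hφ.1 hψ.1

/-- Diagonalising every `N i` turns the sum into a mixture of pure products whose weights are the
eigenvalues; their total is the total trace. -/
theorem sum_kronecker_mem_sepStates [DecidableEq n] {ι : Type*} [Fintype ι]
    {φ : ι → Matrix m m ℂ} (hφ : ∀ i, φ i ∈ pureStates m) {N : ι → Matrix n n ℂ}
    (hN : ∀ i, (N i).PosSemidef) (htr : ∑ i, (N i).trace = 1) :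
    ∑ i, φ i ⊗ₖ N i ∈ sepStates m n := by
  have hH : ∀ i, (N i).IsHermitian := fun i => (hN i).isHermitian
  refine mem_convexHull_of_exists_fintype (ι := ι × n) (fun p => (hH p.1).eigenvalues p.2)
    (fun p => φ p.1 ⊗ₖ ketbra ((hH p.1).eigenvectorBasis p.2)) (fun p => (hN p.1).eigenvalues_nonneg _)
    ?_ (fun p => ⟨_, hφ p.1, _,
      ketbra_mem_pureStates ((hH p.1).eigenvectorBasis.orthonormal.1 p.2), rfl⟩) ?_
  · rw [Fintype.sum_prod_type]
    refine Complex.ofReal_injective ?_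
    rw [Complex.ofReal_one, ← htr, Complex.ofReal_sum]
    refine Finset.sum_congr rfl fun i _ => ?_
    rw [(hH i).trace_eq_sum_eigenvalues]
    simp
  · rw [Fintype.sum_prod_type]
    refine Finset.sum_congr rfl fun i _ => ?_
    conv_rhs => rw [(hH i).eq_sum_ketbra]
    ext p q
    simp only [Matrix.sum_apply, Matrix.smul_apply, Matrix.kroneckerMap_apply, Finset.mul_sum,
      Complex.real_smul, smul_eq_mul]
    exact Finset.sum_congr rfl fun j _ => by ring

end Separable

theorem trNorm_zero {n : Type*} [Fintype n] [DecidableEq n] : trNorm (0 : Matrix n n ℂ) = 0 := by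
  simp [trNorm]

/-! ### The channel: complete positivity, separable outputs and approximation. -/

section NetChannel

variable {d : ℕ} {I : Finset (Matrix (Fin d) (Fin d) ℂ)}
  (e : OrthonormalBasis I ℂ (EuclideanSpace ℂ (Fin I.card)))

theorem netChannel_apply (ρ : Matrix (Fin (I.card * d)) (Fin (I.card * d)) ℂ) :
    netChannel I e ρ = ∑ φ : I, φ.1 ⊗ₖ compress (e φ)
      (Matrix.reindex finProdFinEquiv.symm finProdFinEquiv.symm ρ) :=
  Finset.sum_congr rfl fun φ _ => by rw [ptrace₁_ketbra_mul]

/-- The identification of `ℂ^D ⊗ ℂ^k` with `ℂ^|I| ⊗ (ℂ^d ⊗ ℂ^k)`. -/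
def netEnvEquiv (c d k : ℕ) : Fin (c * d) × Fin k ≃ Fin c × (Fin d × Fin k) :=
  (finProdFinEquiv.symm.prodCongr (Equiv.refl (Fin k))).trans (Equiv.prodAssoc _ _ _)

/-- The environment is merely absorbed into the second factor. Complete positivity and the strong
separability condition both follow from this formula. -/
theorem reindex_tensorId_netChannel {k : ℕ}
    (ρ : Matrix (Fin (I.card * d) × Fin k) (Fin (I.card * d) × Fin k) ℂ) :
    Matrix.reindex (Equiv.prodAssoc (Fin d) (Fin d) (Fin k))
      (Equiv.prodAssoc (Fin d) (Fin d) (Fin k)) (tensorId (Fin k) (netChannel I e) ρ) =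
    ∑ φ : I, φ.1 ⊗ₖ compress (e φ)
      (Matrix.reindex (netEnvEquiv I.card d k) (netEnvEquiv I.card d k) ρ) := by
  ext ⟨i, b, s⟩ ⟨j, c, t⟩
  simp only [Matrix.reindex_apply, Matrix.submatrix_apply, Equiv.prodAssoc_symm_apply, tensorId,
    LinearMap.coe_mk, AddHom.coe_mk, netChannel_apply, Matrix.sum_apply,
    Matrix.kroneckerMap_apply, compress, Matrix.of_apply]
  rfl

theorem trace_reindex {m n : Type*} [Fintype m] [Fintype n] (σ : m ≃ n) (X : Matrix m m ℂ) :
    (Matrix.reindex σ σ X).trace = X.trace :=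
  Fintype.sum_equiv σ.symm _ _ fun _ => rfl

theorem reindex_mem_densityOps {m n : Type*} [Fintype m] [Fintype n] (σ : m ≃ n)
    {X : Matrix m m ℂ} (hX : X ∈ densityOps m) : Matrix.reindex σ σ X ∈ densityOps n :=
  ⟨hX.1.submatrix _, (trace_reindex σ X).trans hX.2⟩

theorem isCPTP_netChannel (hI : ∀ φ ∈ I, φ ∈ pureStates (Fin d)) : IsCPTP (netChannel I e) where
  completelyPositive k X hX := by
    have h := reindex_tensorId_netChannel e X
    have hpsd : (Matrix.reindex (Equiv.prodAssoc (Fin d) (Fin d) (Fin k))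
        (Equiv.prodAssoc (Fin d) (Fin d) (Fin k)) (tensorId (Fin k) (netChannel I e) X)).PosSemidef := by
      rw [h]
      exact Matrix.posSemidef_sum _ fun φ _ =>
        (hI φ.1 φ.2).1.1.kronecker (posSemidef_compress _ (hX.submatrix _))
    exact (Matrix.posSemidef_submatrix_equiv _).1 hpsd
  tracePreserving X := by
    rw [netChannel_apply, Matrix.trace_sum, ← trace_reindex finProdFinEquiv.symm X,
      ← sum_trace_compress e]
    refine Finset.sum_congr rfl fun φ _ => ?_
    rw [Matrix.trace_kronecker, (hI φ.1 φ.2).1.2, one_mul]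

theorem netChannel_mem_sepStates (hI : ∀ φ ∈ I, φ ∈ pureStates (Fin d))
    {ρ : Matrix (Fin (I.card * d)) (Fin (I.card * d)) ℂ} (hρ : ρ ∈ densityOps (Fin (I.card * d))) :
    netChannel I e ρ ∈ sepStates (Fin d) (Fin d) := by
  have h := reindex_mem_densityOps finProdFinEquiv.symm hρ
  rw [netChannel_apply]
  exact sum_kronecker_mem_sepStates (fun φ : I => hI φ.1 φ.2)
    (fun φ => posSemidef_compress (e φ) h.1) ((sum_trace_compress e _).trans h.2)

theorem tensorId_netChannel_mem_sepStates (hI : ∀ φ ∈ I, φ ∈ pureStates (Fin d)) {k : ℕ}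
    {ρ : Matrix (Fin (I.card * d) × Fin k) (Fin (I.card * d) × Fin k) ℂ}
    (hρ : ρ ∈ densityOps (Fin (I.card * d) × Fin k)) :
    Matrix.reindex (Equiv.prodAssoc (Fin d) (Fin d) (Fin k))
      (Equiv.prodAssoc (Fin d) (Fin d) (Fin k)) (tensorId (Fin k) (netChannel I e) ρ) ∈
      sepStates (Fin d) (Fin d × Fin k) := by
  have h := reindex_mem_densityOps (netEnvEquiv I.card d k) hρ
  rw [reindex_tensorId_netChannel]
  exact sum_kronecker_mem_sepStates (fun φ : I => hI φ.1 φ.2)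
    (fun φ => posSemidef_compress (e φ) h.1) ((sum_trace_compress e _).trans h.2)

/-- Mixtures of net states tensor any state are exact outputs of the channel. -/
theorem exists_netChannel_eq_kronecker {κ : Matrix (Fin d) (Fin d) ℂ}
    (hκ : κ ∈ convexHull ℝ (I : Set (Matrix (Fin d) (Fin d) ℂ))) {ψ : Matrix (Fin d) (Fin d) ℂ}
    (hψ : ψ ∈ densityOps (Fin d)) :
    ∃ ρ ∈ densityOps (Fin (I.card * d)), netChannel I e ρ = κ ⊗ₖ ψ := by
  obtain ⟨w, hw0, hw1, rfl⟩ := Finset.mem_convexHull'.1 hκ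
  have hb := e.orthonormal
  have hketbra : ∀ φ : I, ketbra (e φ) ⊗ₖ ψ ∈ densityOps (Fin I.card × Fin d) := fun φ =>
    kronecker_mem_densityOps (ketbra_mem_pureStates (hb.1 φ)).1 hψ
  -- The input is a classical-quantum state: measuring the basis `e` returns the label `φ` with
  -- probability `w φ` and leaves `ψ`.
  have hmem : ∑ φ : I, w φ.1 • (ketbra (e φ) ⊗ₖ ψ) ∈ densityOps (Fin I.card × Fin d) :=
    (convex_posSemidef_trace_eq 1).sum_mem (fun φ _ => hw0 φ.1 φ.2)
      ((Finset.sum_coe_sort I w).trans hw1) fun φ _ => hketbra φ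
  refine ⟨_, reindex_mem_densityOps finProdFinEquiv hmem, ?_⟩
  have hre : Matrix.reindex finProdFinEquiv.symm finProdFinEquiv.symm
      (Matrix.reindex finProdFinEquiv finProdFinEquiv (∑ φ : I, w φ.1 • (ketbra (e φ) ⊗ₖ ψ)))
      = ∑ φ : I, w φ.1 • (ketbra (e φ) ⊗ₖ ψ) := by
    ext p q
    simp
  have hc : ∀ φ : I, compress (e φ) (∑ χ : I, w χ.1 • (ketbra (e χ) ⊗ₖ ψ)) = w φ.1 • ψ := by
    intro φ
    rw [compress_sum, Finset.sum_eq_single φ]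
    · simp [compress_smul, compress_ketbra_kronecker, hb.1]
    · intro χ _ hχ
      simp [compress_smul, compress_ketbra_kronecker, hb.2 hχ.symm]
    · simp
  rw [netChannel_apply, hre]
  simp_rw [hc]
  rw [← Finset.sum_coe_sort I fun φ => w φ • φ]
  ext p q
  simp only [Matrix.sum_apply, Matrix.smul_apply, Matrix.kroneckerMap_apply, Finset.sum_mul,
    Complex.real_smul]
  exact Finset.sum_congr rfl fun φ _ => by ring

theorem exists_trNorm_netChannel_sub_le {δ : ℝ} (hδ : 0 ≤ δ) (hI : IsPureNet (√δ) I)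
    {σ : Matrix (Fin d × Fin d) (Fin d × Fin d) ℂ} (hσ : σ ∈ sepStates (Fin d) (Fin d)) :
    ∃ ρ ∈ densityOps (Fin (I.card * d)), trNorm (netChannel I e ρ - σ) ≤ δ := by
  -- The target is strengthened to an operator inequality with error of trace `δ`, because this
  -- condition is convex in `σ` and hence needs checking only on pure products.
  let S : Set (Matrix (Fin d × Fin d) (Fin d × Fin d) ℂ) :=
    {σ | ∃ ρ ∈ densityOps (Fin (I.card * d)), ∃ P : Matrix (Fin d × Fin d) (Fin d × Fin d) ℂ,
      (P.PosSemidef ∧ P.trace = δ) ∧ (netChannel I e ρ + P - σ).PosSemidef}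
  have hS : sepStates (Fin d) (Fin d) ⊆ S := by
    refine convexHull_min ?_ ?_
    · rintro _ ⟨φ, hφ, ψ, hψ, rfl⟩
      obtain ⟨κ, hκ, P, hP, htr, hpos⟩ := exists_convexHull_add_posSemidef hδ hI hφ
      obtain ⟨ρ, hρ, hρe⟩ := exists_netChannel_eq_kronecker e hκ hψ.1
      refine ⟨ρ, hρ, P ⊗ₖ ψ, ⟨hP.kronecker hψ.1.1, ?_⟩, ?_⟩
      · rw [Matrix.trace_kronecker, htr, hψ.1.2, mul_one]
      · have e1 : κ ⊗ₖ ψ + P ⊗ₖ ψ - φ ⊗ₖ ψ = (κ + P - φ) ⊗ₖ ψ := by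
          ext p q
          simp [add_mul, sub_mul]
        rw [hρe, e1]
        exact hpos.kronecker hψ.1.1
    · rintro σ₁ ⟨ρ₁, hρ₁, P₁, hP₁, h₁⟩ σ₂ ⟨ρ₂, hρ₂, P₂, hP₂, h₂⟩ a b ha hb hab
      refine ⟨a • ρ₁ + b • ρ₂, convex_posSemidef_trace_eq 1 hρ₁ hρ₂ ha hb hab, a • P₁ + b • P₂,
        convex_posSemidef_trace_eq _ hP₁ hP₂ ha hb hab, ?_⟩
      have := convex_posSemidef h₁ h₂ ha hb hab
      have e1 : netChannel I e (a • ρ₁ + b • ρ₂)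
          = a • netChannel I e ρ₁ + b • netChannel I e ρ₂ := by
        rw [map_add, LinearMap.map_smul_of_tower, LinearMap.map_smul_of_tower]
      have e2 : netChannel I e (a • ρ₁ + b • ρ₂) + (a • P₁ + b • P₂) - (a • σ₁ + b • σ₂)
          = a • (netChannel I e ρ₁ + P₁ - σ₁) + b • (netChannel I e ρ₂ + P₂ - σ₂) := by
        rw [e1]
        simp only [smul_add, smul_sub]
        abel
      rw [e2]
      exact this
  obtain ⟨ρ, hρ, P, ⟨hP, htr⟩, hpos⟩ := hS hσ
  refine ⟨ρ, hρ, ?_⟩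
  have h := trNorm_sub_le hpos hP
  -- Both `netChannel I e ρ` and `σ` have trace one, so the slack has the same trace `δ` as `P`; the
  -- two halves in `trNorm_sub_le` add up to `δ`.
  have htr' : (netChannel I e ρ + P - σ).trace = δ := by
    rw [Matrix.trace_sub, Matrix.trace_add, (isCPTP_netChannel e hI.1).tracePreserving, hρ.2, htr,
      (sepStates_subset_densityOps hσ).2]
    ring
  rw [htr', htr, Complex.ofReal_re] at h
  have e1 : netChannel I e ρ + P - σ - P = netChannel I e ρ - σ := by abel
  rw [e1] at h
  linarith

theorem isDisentangler_netChannel {δ : ℝ} (hδ : 0 ≤ δ) (hI : IsPureNet (√δ) I) :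
    IsDisentangler 0 δ (netChannel I e) where
  cptp := isCPTP_netChannel e hI.1
  nearSeparable ρ hρ := ⟨_, netChannel_mem_sepStates e hI.1 hρ, by rw [sub_self, trNorm_zero]⟩
  approximatesSeparable _ hσ := exists_trNorm_netChannel_sub_le e hδ hI hσ

theorem isStrongDisentangler_netChannel {δ : ℝ} (hδ : 0 ≤ δ) (hI : IsPureNet (√δ) I) :
    IsStrongDisentangler 0 δ (netChannel I e) where
  cptp := isCPTP_netChannel e hI.1
  nearSeparable _ ρ hρ :=
    ⟨_, tensorId_netChannel_mem_sepStates e hI.1 hρ, by rw [sub_self, trNorm_zero]⟩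
  approximatesSeparable _ hσ := exists_trNorm_netChannel_sub_le e hδ hI hσ

end NetChannel

/-! ### Covering by greedy balls and a maximal packing. -/

section Covering

open MeasureTheory

variable {Ω M : Type*} [MeasurableSpace Ω] [PseudoMetricSpace M] [SecondCountableTopology M]
  [MeasurableSpace M] [OpensMeasurableSpace M]

theorem measurableSet_dist_le {F : Ω → M} (hF : Measurable F) (x : Ω) (r : ℝ) :
    MeasurableSet {y | dist (F x) (F y) ≤ r} :=
  measurableSet_le (measurable_const.dist hF) measurable_const

/-- Some ball catches at least its average share of a measurable set. -/
theorem exists_measure_diff_ball_le (μ : Measure Ω) [IsProbabilityMeasure μ] {F : Ω → M}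
    (hF : Measurable F) {r v : ℝ} (hv0 : 0 ≤ v)
    (hv : ∀ x, v ≤ μ.real {y | dist (F x) (F y) ≤ r}) {U : Set Ω} (hU : MeasurableSet U) :
    ∃ x, μ.real (U \ {y | dist (F x) (F y) ≤ r}) ≤ (1 - v) * μ.real U := by
  have hS : MeasurableSet {p : Ω × Ω | dist (F p.1) (F p.2) ≤ r ∧ p.2 ∈ U} :=
    (measurableSet_le ((hF.comp measurable_fst).dist (hF.comp measurable_snd))
      measurable_const).inter (measurable_snd hU)
  have h1 : ∫⁻ x, μ (U ∩ {y | dist (F x) (F y) ≤ r}) ∂μ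
      = ∫⁻ y in U, μ {x | dist (F y) (F x) ≤ r} ∂μ := by
    have e1 := Measure.prod_apply (μ := μ) (ν := μ) hS
    have e2 := Measure.prod_apply_symm (μ := μ) (ν := μ) hS
    rw [e1] at e2
    convert e2 using 1
    · refine lintegral_congr fun x => ?_
      congr 1
      ext y
      simp [and_comm]
    · rw [← lintegral_indicator hU]
      refine lintegral_congr fun y => ?_
      by_cases hy : y ∈ U
      · simp only [Set.indicator_of_mem hy]
        congr 1
        ext x
        simp [hy, dist_comm]
      · simp [hy]
  have h2 : ENNReal.ofReal (v * μ.real U) ≤ ∫⁻ x, μ (U ∩ {y | dist (F x) (F y) ≤ r}) ∂μ := by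
    rw [h1]
    calc ENNReal.ofReal (v * μ.real U) = ∫⁻ _ in U, ENNReal.ofReal v ∂μ := by
          rw [setLIntegral_const, ENNReal.ofReal_mul hv0, ofReal_measureReal]
      _ ≤ _ := lintegral_mono fun y => by
          rw [← ofReal_measureReal (μ := μ)]
          exact ENNReal.ofReal_le_ofReal (hv y)
  obtain ⟨x, hx⟩ := exists_lintegral_le (μ := μ)
    (f := fun x => μ (U ∩ {y | dist (F x) (F y) ≤ r})) (ne_of_lt (lt_of_le_of_lt
      (lintegral_mono fun x => prob_le_one) (by simp)))
  refine ⟨x, ?_⟩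
  have h3 := ENNReal.ofReal_le_iff_le_toReal (measure_ne_top _ _) |>.1 (h2.trans hx)
  have h4 := measureReal_inter_add_sdiff (μ := μ) (s := U) (measurableSet_dist_le hF x r)
  change _ ≤ μ.real _ at h3
  linarith

/-- `N` balls can be chosen so that the uncovered measure is at most `(1 - v) ^ N`. -/
theorem exists_finset_uncovered_le (μ : Measure Ω) [IsProbabilityMeasure μ] {F : Ω → M}
    (hF : Measurable F) {r v : ℝ} (hv0 : 0 ≤ v) (hv1 : v ≤ 1)
    (hv : ∀ x, v ≤ μ.real {y | dist (F x) (F y) ≤ r}) (N : ℕ) :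
    ∃ J : Finset Ω, J.card ≤ N ∧ μ.real {y | ∀ x ∈ J, r < dist (F x) (F y)} ≤ (1 - v) ^ N := by
  classical
  induction N with
  | zero => exact ⟨∅, by simp⟩
  | succ N ih =>
    obtain ⟨J, hJ, hJμ⟩ := ih
    have hU : MeasurableSet {y | ∀ x ∈ J, r < dist (F x) (F y)} := by
      have : {y | ∀ x ∈ J, r < dist (F x) (F y)} = ⋂ x ∈ J, {y | dist (F x) (F y) ≤ r}ᶜ := by
        ext y
        simp
      rw [this]
      exact Finset.measurableSet_biInter _ fun x _ => (measurableSet_dist_le hF x r).compl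
    obtain ⟨x, hx⟩ := exists_measure_diff_ball_le μ hF hv0 hv hU
    refine ⟨insert x J, (Finset.card_insert_le _ _).trans (by omega), ?_⟩
    have : {y | ∀ z ∈ insert x J, r < dist (F z) (F y)}
        = {y | ∀ x ∈ J, r < dist (F x) (F y)} \ {y | dist (F x) (F y) ≤ r} := by
      ext y
      simp [and_comm]
    rw [this, pow_succ']
    exact hx.trans (mul_le_mul_of_nonneg_left hJμ (by linarith))

/-- A finite covering by balls of radius `r + ε`: random balls of radius `r`, completed by a
maximal packing of balls of radius `ε` in the uncovered part. -/
theorem exists_finset_cover (μ : Measure Ω) [IsProbabilityMeasure μ] {F : Ω → M}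
    (hF : Measurable F) {r ε v w : ℝ} (hε : 0 ≤ ε) (hεr : ε ≤ r) (hv0 : 0 ≤ v) (hv1 : v ≤ 1)
    (hv : ∀ x, v ≤ μ.real {y | dist (F x) (F y) ≤ r}) (hw0 : 0 < w)
    (hw : ∀ x, w ≤ μ.real {y | dist (F x) (F y) ≤ ε}) (N : ℕ) :
    ∃ J : Finset Ω, (J.card : ℝ) ≤ N + (1 - v) ^ N / w ∧
      ∀ y, ∃ x ∈ J, dist (F x) (F y) ≤ r + ε := by
  classical
  obtain ⟨J, hJ, hJμ⟩ := exists_finset_uncovered_le μ hF hv0 hv1 hv N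
  set U := {y | ∀ x ∈ J, r < dist (F x) (F y)} with hUdef
  -- Distance more than `r + ε` from `J` keeps the `ε`-balls inside the uncovered set, and
  -- separation more than `2 * ε` makes them disjoint; comparing measures then bounds the size of
  -- `T`.
  let good : Finset Ω → Prop := fun T =>
    (∀ t ∈ T, ∀ x ∈ J, r + ε < dist (F x) (F t)) ∧
      ∀ s ∈ T, ∀ t ∈ T, s ≠ t → 2 * ε < dist (F s) (F t)
  have hcard : ∀ T, good T → (T.card : ℝ) ≤ (1 - v) ^ N / w := by
    intro T hT
    rw [le_div_iff₀ hw0]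
    have hdisj : Set.PairwiseDisjoint (T : Set Ω) fun t => {y | dist (F t) (F y) ≤ ε} := by
      intro s hs t ht hst
      refine Set.disjoint_left.2 fun y hy hy' => ?_
      have h1 := hT.2 s hs t ht hst
      have h2 := dist_triangle_right (F s) (F t) (F y)
      simp only [Set.mem_ofPred_eq] at hy hy'
      linarith
    have hsub : (⋃ t ∈ T, {y | dist (F t) (F y) ≤ ε}) ⊆ U := by
      intro y hy
      simp only [Set.mem_iUnion, Set.mem_ofPred_eq] at hy
      obtain ⟨t, ht, hty⟩ := hy
      intro x hx
      have h1 := hT.1 t ht x hx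
      have h2 := dist_triangle_right (F x) (F t) (F y)
      linarith
    calc (T.card : ℝ) * w = ∑ _t ∈ T, w := by simp
      _ ≤ ∑ t ∈ T, μ.real {y | dist (F t) (F y) ≤ ε} := Finset.sum_le_sum fun t _ => hw t
      _ = μ.real (⋃ t ∈ T, {y | dist (F t) (F y) ≤ ε}) :=
          (measureReal_biUnion_finset hdisj fun t _ => measurableSet_dist_le hF t ε).symm
      _ ≤ μ.real U := measureReal_mono hsub
      _ ≤ _ := hJμ
  obtain ⟨T, hT, hmax⟩ : ∃ T, good T ∧ ∀ T', good T' → T'.card ≤ T.card := by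
    have hb : ∀ k, (∃ T, good T ∧ T.card = k) → k ≤ ⌊(1 - v) ^ N / w⌋₊ := by
      rintro k ⟨T, hT, rfl⟩
      exact Nat.le_floor (hcard T hT)
    have h0 : ∃ T, good T ∧ T.card = 0 := ⟨∅, by simp [good], rfl⟩
    obtain ⟨T, hT, hTc⟩ := Nat.findGreatest_spec (P := fun k => ∃ T, good T ∧ T.card = k)
      (Nat.zero_le ⌊(1 - v) ^ N / w⌋₊) h0
    exact ⟨T, hT, fun T' hT' => hTc ▸ Nat.le_findGreatest (hb _ ⟨T', hT', rfl⟩) ⟨T', hT', rfl⟩⟩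
  refine ⟨J ∪ T, ?_, fun y => ?_⟩
  · calc ((J ∪ T).card : ℝ) ≤ (J.card : ℝ) + T.card := by exact_mod_cast Finset.card_union_le J T
      _ ≤ _ := add_le_add (by exact_mod_cast hJ) (hcard T hT)
  · by_contra! hy
    -- Here `ε ≤ r` is what turns distance `r + ε` into separation `2 * ε`, so that an uncovered `y`
    -- could be added to the maximal `T`.
    have hyT : ∀ t ∈ T, 2 * ε < dist (F t) (F y) := fun t ht => by
      linarith [hy t (Finset.mem_union_right _ ht)]
    have hyn : y ∉ T := fun h => by
      have := hyT y h
      rw [dist_self] at this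
      linarith
    have hgood : good (insert y T) := by
      refine ⟨fun t ht x hx => ?_, fun s hs t ht hst => ?_⟩
      · rcases Finset.mem_insert.1 ht with rfl | ht
        · exact hy x (Finset.mem_union_left _ hx)
        · exact hT.1 t ht x hx
      · rcases Finset.mem_insert.1 hs with hs' | hs' <;>
          rcases Finset.mem_insert.1 ht with ht' | ht'
        · exact absurd (hs'.trans ht'.symm) hst
        · rw [hs', dist_comm]
          exact hyT t ht'
        · rw [ht']
          exact hyT s hs'
        · exact hT.2 s hs' t ht' hst
    have := hmax _ hgood
    rw [Finset.card_insert_of_notMem hyn] at this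
    omega

end Covering

/-! ### Gaussian integrals over quadratic cones in real spaces. -/

section Gaussian

open MeasureTheory

theorem lintegral_exp_neg_mul_sq_norm (V : Type*) [NormedAddCommGroup V] [InnerProductSpace ℝ V]
    [FiniteDimensional ℝ V] [MeasurableSpace V] [BorelSpace V] {n : ℕ}
    (hn : Module.finrank ℝ V = 2 * n) {b : ℝ} (hb : 0 < b) :
    ∫⁻ v : V, ENNReal.ofReal (Real.exp (-b * ‖v‖ ^ 2)) = ENNReal.ofReal ((Real.pi / b) ^ n) := by
  have h := GaussianFourier.integral_rexp_neg_mul_sq_norm (V := V) hb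
  have e : ((Module.finrank ℝ V : ℝ) / 2) = (n : ℝ) := by
    rw [hn]
    push_cast
    ring
  rw [e, Real.rpow_natCast] at h
  have hpos : 0 < (Real.pi / b) ^ n := by positivity
  have hint : Integrable fun v : V => Real.exp (-b * ‖v‖ ^ 2) := by
    by_contra hc
    rw [integral_undef hc] at h
    exact hpos.ne h
  rw [← ofReal_integral_eq_lintegral_ofReal hint (ae_of_all _ fun v => (Real.exp_pos _).le), h]

theorem setLIntegral_Ioi_mul_exp_neg_sq {a : ℝ} (ha : 0 ≤ a) :
    ∫⁻ r in Set.Ioi a, ENNReal.ofReal (r * Real.exp (-r ^ 2))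
      = ENNReal.ofReal (Real.exp (-a ^ 2) / 2) := by
  have hd : ∀ x : ℝ, HasDerivAt (fun r : ℝ => -Real.exp (-r ^ 2) / 2) (x * Real.exp (-x ^ 2)) x := by
    intro x
    have := ((((hasDerivAt_id x).pow 2).neg.exp).neg).div_const 2
    convert! this using 1
    simp
    ring
  have hlim : Filter.Tendsto (fun r : ℝ => -Real.exp (-r ^ 2) / 2) Filter.atTop (nhds 0) := by
    have h1 : Filter.Tendsto (fun r : ℝ => Real.exp (-r ^ 2)) Filter.atTop (nhds 0) :=
      Real.tendsto_exp_neg_atTop_nhds_zero.comp (Filter.tendsto_pow_atTop two_ne_zero)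
    simpa using h1.neg.div_const 2
  have hnn : ∀ x ∈ Set.Ioi a, 0 ≤ x * Real.exp (-x ^ 2) := fun x hx =>
    mul_nonneg (ha.trans (le_of_lt hx)) (Real.exp_pos _).le
  have hint := integrableOn_Ioi_deriv_of_nonneg' (fun x _ => hd x) hnn hlim
  have hval := integral_Ioi_of_hasDerivAt_of_nonneg' (fun x _ => hd x) hnn hlim
  rw [← ofReal_integral_eq_lintegral_ofReal hint
    ((ae_restrict_iff' measurableSet_Ioi).2 (ae_of_all _ hnn)), hval]
  congr 1
  ring

theorem le_setLIntegral_exp_neg_sq_complex {t : ℝ} (ht : 0 ≤ t) :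
    ENNReal.ofReal (Real.pi * Real.exp (-t)) ≤
      ∫⁻ z in {z : ℂ | t ≤ ‖z‖ ^ 2}, ENNReal.ofReal (Real.exp (-‖z‖ ^ 2)) := by
  have hm : MeasurableSet {z : ℂ | t ≤ ‖z‖ ^ 2} :=
    measurableSet_le measurable_const (by fun_prop)
  rw [← lintegral_indicator hm, ← Complex.lintegral_comp_polarCoord_symm]
  have hsub : Set.Ioi (√t) ×ˢ Set.Ioo (-Real.pi) Real.pi ⊆ polarCoord.target := by
    rw [polarCoord_target]
    exact Set.prod_mono (Set.Ioi_subset_Ioi (Real.sqrt_nonneg t)) subset_rfl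
  refine le_trans ?_ (lintegral_mono_set hsub)
  have hcongr : ∫⁻ p in Set.Ioi (√t) ×ˢ Set.Ioo (-Real.pi) Real.pi, ENNReal.ofReal p.1 •
        Set.indicator {z : ℂ | t ≤ ‖z‖ ^ 2} (fun z => ENNReal.ofReal (Real.exp (-‖z‖ ^ 2)))
          (Complex.polarCoord.symm p)
      = ∫⁻ p in Set.Ioi (√t) ×ˢ Set.Ioo (-Real.pi) Real.pi,
          ENNReal.ofReal (p.1 * Real.exp (-p.1 ^ 2)) * 1 := by
    refine setLIntegral_congr_fun (measurableSet_Ioi.prod measurableSet_Ioo) fun p hp => ?_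
    have hp1 : √t < p.1 := hp.1
    have hp0 : 0 ≤ p.1 := (Real.sqrt_nonneg t).trans hp1.le
    have hmem : Complex.polarCoord.symm p ∈ {z : ℂ | t ≤ ‖z‖ ^ 2} := by
      simp only [Set.mem_ofPred_eq, Complex.norm_polarCoord_symm, sq_abs]
      exact (Real.sqrt_le_left hp0).1 hp1.le
    simp only [Set.indicator_of_mem hmem, Complex.norm_polarCoord_symm, sq_abs, smul_eq_mul, mul_one]
    rw [ENNReal.ofReal_mul hp0]
  rw [hcongr, Measure.volume_eq_prod, ← Measure.prod_restrict,
    lintegral_prod_mul (f := fun r => ENNReal.ofReal (r * Real.exp (-r ^ 2))) (g := fun _ => 1)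
      (by fun_prop) (by fun_prop), setLIntegral_Ioi_mul_exp_neg_sq (Real.sqrt_nonneg t),
    Real.sq_sqrt ht]
  simp only [lintegral_const, Measure.restrict_apply MeasurableSet.univ, Set.univ_inter, one_mul,
    Real.volume_Ioo]
  rw [← ENNReal.ofReal_mul (by positivity)]
  refine ENNReal.ofReal_le_ofReal (le_of_eq ?_)
  ring

theorem le_setLIntegral_exp_neg_sq_of_finrank_two (U : Type*) [NormedAddCommGroup U]
    [InnerProductSpace ℝ U] [FiniteDimensional ℝ U] [MeasurableSpace U] [BorelSpace U]
    (hU : Module.finrank ℝ U = 2) {t : ℝ} (ht : 0 ≤ t) :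
    ENNReal.ofReal (Real.pi * Real.exp (-t)) ≤
      ∫⁻ z in {z : U | t ≤ ‖z‖ ^ 2}, ENNReal.ofReal (Real.exp (-‖z‖ ^ 2)) := by
  let g : U ≃ₗᵢ[ℝ] ℂ := ((stdOrthonormalBasis ℝ U).reindex (finCongr hU)).repr.trans
    Complex.orthonormalBasisOneI.repr.symm
  refine (le_setLIntegral_exp_neg_sq_complex ht).trans (le_of_eq ?_)
  rw [← (g.measurePreserving).setLIntegral_comp_preimage_emb
    g.toHomeomorph.measurableEmbedding]
  simp

/-- For fixed `v` the planar integral over `‖u‖² ≥ c ‖v‖²` contributes `π exp (-c ‖v‖²)`; the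
remaining Gaussian in `v` has exponent `1 + c` and integral `(π / (1 + c)) ^ n`. -/
theorem le_setLIntegral_exp_neg_sq_prod (U V : Type*) [NormedAddCommGroup U]
    [InnerProductSpace ℝ U] [FiniteDimensional ℝ U] [MeasurableSpace U] [BorelSpace U]
    [NormedAddCommGroup V]
    [InnerProductSpace ℝ V] [FiniteDimensional ℝ V] [MeasurableSpace V] [BorelSpace V]
    (hU : Module.finrank ℝ U = 2) {n : ℕ} (hV : Module.finrank ℝ V = 2 * n) {c : ℝ} (hc : 0 ≤ c) :
    ENNReal.ofReal (Real.pi ^ (n + 1) / (1 + c) ^ n) ≤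
      ∫⁻ p in {p : U × V | c * ‖p.2‖ ^ 2 ≤ ‖p.1‖ ^ 2},
        ENNReal.ofReal (Real.exp (-(‖p.1‖ ^ 2 + ‖p.2‖ ^ 2))) := by
  have hm : MeasurableSet {p : U × V | c * ‖p.2‖ ^ 2 ≤ ‖p.1‖ ^ 2} :=
    measurableSet_le (by fun_prop) (by fun_prop)
  rw [← lintegral_indicator hm, Measure.volume_eq_prod, lintegral_prod_symm' _
    (Measurable.indicator (by fun_prop) hm)]
  have hpt : ∀ v : V, ENNReal.ofReal Real.pi * ENNReal.ofReal (Real.exp (-(1 + c) * ‖v‖ ^ 2)) ≤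
      ∫⁻ u : U, Set.indicator {p : U × V | c * ‖p.2‖ ^ 2 ≤ ‖p.1‖ ^ 2}
        (fun p => ENNReal.ofReal (Real.exp (-(‖p.1‖ ^ 2 + ‖p.2‖ ^ 2)))) (u, v) := by
    intro v
    have h := le_setLIntegral_exp_neg_sq_of_finrank_two U hU (t := c * ‖v‖ ^ 2) (by positivity)
    have hm' : MeasurableSet {u : U | c * ‖v‖ ^ 2 ≤ ‖u‖ ^ 2} :=
      measurableSet_le (by fun_prop) (by fun_prop)
    rw [← lintegral_indicator hm'] at h
    have e : (fun u : U => Set.indicator {p : U × V | c * ‖p.2‖ ^ 2 ≤ ‖p.1‖ ^ 2}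
        (fun p => ENNReal.ofReal (Real.exp (-(‖p.1‖ ^ 2 + ‖p.2‖ ^ 2)))) (u, v))
        = fun u => ENNReal.ofReal (Real.exp (-‖v‖ ^ 2)) *
          Set.indicator {u : U | c * ‖v‖ ^ 2 ≤ ‖u‖ ^ 2}
            (fun z => ENNReal.ofReal (Real.exp (-‖z‖ ^ 2))) u := by
      funext u
      by_cases hu : c * ‖v‖ ^ 2 ≤ ‖u‖ ^ 2
      · rw [Set.indicator_of_mem (by exact hu), Set.indicator_of_mem (by exact hu),
          ← ENNReal.ofReal_mul (Real.exp_pos _).le, ← Real.exp_add]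
        congr 2
        ring
      · rw [Set.indicator_of_notMem (by exact hu), Set.indicator_of_notMem (by exact hu), mul_zero]
    rw [e, lintegral_const_mul _ (Measurable.indicator (by fun_prop) hm')]
    refine le_trans (le_of_eq ?_) (mul_le_mul_right h _)
    rw [← ENNReal.ofReal_mul Real.pi_pos.le, ← ENNReal.ofReal_mul (Real.exp_pos _).le]
    congr 1
    rw [mul_left_comm, ← Real.exp_add]
    congr 2
    ring
  refine le_trans (le_of_eq ?_) (lintegral_mono hpt)
  rw [lintegral_const_mul _ (by fun_prop),
    lintegral_exp_neg_mul_sq_norm V hV (by positivity : 0 < 1 + c),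
    ← ENNReal.ofReal_mul Real.pi_pos.le]
  congr 1
  rw [div_pow]
  ring

/-- The splitting into `K` and its orthogonal complement preserves volume and adds squared norms,
which reduces the cone around `K` to the product case. -/
theorem le_setLIntegral_exp_neg_sq_submodule {E : Type*} [NormedAddCommGroup E]
    [InnerProductSpace ℝ E] [FiniteDimensional ℝ E] [MeasurableSpace E] [BorelSpace E]
    (K : Submodule ℝ E) (hK : Module.finrank ℝ K = 2) {n : ℕ}
    (hE : Module.finrank ℝ E = 2 * (n + 1)) {c : ℝ} (hc : 0 ≤ c) :
    ENNReal.ofReal (Real.pi ^ (n + 1) / (1 + c) ^ n) ≤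
      ∫⁻ z in {z : E | c * (‖z‖ ^ 2 - ‖K.orthogonalProjectionOnto z‖ ^ 2)
          ≤ ‖K.orthogonalProjectionOnto z‖ ^ 2},
        ENNReal.ofReal (Real.exp (-‖z‖ ^ 2)) := by
  have hKo : Module.finrank ℝ Kᗮ = 2 * n := by
    have := K.finrank_add_finrank_orthogonal
    omega
  refine (le_setLIntegral_exp_neg_sq_prod K Kᗮ hK hKo hc).trans (le_of_eq ?_)
  have hmp : MeasurePreserving (fun z : E => WithLp.ofLp (K.orthogonalDecomposition z)) :=
    (WithLp.volume_preserving_ofLp K Kᗮ).comp K.orthogonalDecomposition.measurePreserving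
  have hemb : MeasurableEmbedding (fun z : E => WithLp.ofLp (K.orthogonalDecomposition z)) :=
    (MeasurableEquiv.toLp 2 (K × Kᗮ)).symm.measurableEmbedding.comp
      K.orthogonalDecomposition.toHomeomorph.measurableEmbedding
  have hsq : ∀ z : E, ‖z‖ ^ 2 = ‖K.orthogonalProjectionOnto z‖ ^ 2
      + ‖Kᗮ.orthogonalProjectionOnto z‖ ^ 2 := fun z => by
    have := K.norm_sq_eq_add_norm_sq_projection z
    simpa using this
  rw [← hmp.setLIntegral_comp_preimage_emb hemb]
  have hset : (fun z : E => WithLp.ofLp (K.orthogonalDecomposition z)) ⁻¹'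
      {p : K × Kᗮ | c * ‖p.2‖ ^ 2 ≤ ‖p.1‖ ^ 2} =
      {z : E | c * (‖z‖ ^ 2 - ‖K.orthogonalProjectionOnto z‖ ^ 2)
          ≤ ‖K.orthogonalProjectionOnto z‖ ^ 2} := by
    ext z
    simp [hsq z]
  rw [hset]
  refine lintegral_congr fun z => ?_
  rw [hsq z]
  simp

end Gaussian

/-! ### Caps around complex lines, seen as real planes. -/

section ComplexGaussian

open MeasureTheory

attribute [local instance] InnerProductSpace.complexToReal

variable {E : Type*} [NormedAddCommGroup E] [InnerProductSpace ℂ E]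

theorem finrank_restrictScalars_span_singleton {w : E} (hw : w ≠ 0) :
    Module.finrank ℝ ((Submodule.span ℂ {w}).restrictScalars ℝ) = 2 := by
  change Module.finrank ℝ (Submodule.span ℂ {w}) = 2
  rw [finrank_real_of_complex, finrank_span_singleton hw]

theorem norm_orthogonalProjectionOnto_restrictScalars_span [FiniteDimensional ℝ E] {w : E}
    (hw : ‖w‖ = 1) (z : E) :
    ‖((Submodule.span ℂ {w}).restrictScalars ℝ).orthogonalProjectionOnto z‖ = ‖inner ℂ w z‖ := by
  have h : ((Submodule.span ℂ {w}).restrictScalars ℝ).starProjection z = inner ℂ w z • w := by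
    refine Submodule.eq_starProjection_of_mem_of_inner_eq_zero ?_ fun u hu => ?_
    · exact Submodule.mem_span_singleton.2 ⟨_, rfl⟩
    · obtain ⟨a, rfl⟩ := Submodule.mem_span_singleton.1
        (show u ∈ Submodule.span ℂ {w} from hu)
      -- Complex orthogonality implies real orthogonality, so the complex projection onto the line
      -- is also the real one.
      have : inner ℂ (z - inner ℂ w z • w) (a • w) = 0 := by
        rw [inner_smul_right, inner_sub_left, inner_smul_left, inner_self_eq_norm_sq_to_K, hw]
        simp
      rw [real_inner_eq_re_inner ℂ, this]
      simp
  have h' := congrArg norm h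
  rwa [norm_smul, hw, mul_one] at h'

/-- The Gaussian probability measure: the cap of squared radius `s` around any complex line has
measure at least `s ^ n` in dimension `n + 1`. -/
theorem exists_isProbabilityMeasure_cap [FiniteDimensional ℂ E] [MeasurableSpace E] [BorelSpace E]
    {n : ℕ} (hE : Module.finrank ℂ E = n + 1) :
    ∃ μ : Measure E, IsProbabilityMeasure μ ∧ ∀ w : E, ‖w‖ = 1 → ∀ s : ℝ, 0 < s → s ≤ 1 →
      s ^ n ≤ μ.real {z | z ≠ 0 ∧ (1 - s) * ‖z‖ ^ 2 ≤ ‖inner ℂ w z‖ ^ 2} := by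
  have : FiniteDimensional ℝ E := FiniteDimensional.complexToReal E
  have hER : Module.finrank ℝ E = 2 * (n + 1) := by rw [finrank_real_of_complex, hE]
  have : Nontrivial E := Module.nontrivial_of_finrank_pos (R := ℂ) (by omega)
  have hpi : 0 < Real.pi ^ (n + 1) := by positivity
  let ν : Measure E := volume.withDensity fun z => ENNReal.ofReal (Real.exp (-‖z‖ ^ 2))
  have hν : ν Set.univ = ENNReal.ofReal (Real.pi ^ (n + 1)) := by
    have := lintegral_exp_neg_mul_sq_norm E hER one_pos
    simp only [neg_mul, one_mul, div_one] at this
    rw [withDensity_apply _ MeasurableSet.univ, setLIntegral_univ, this]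
  have hμ : IsProbabilityMeasure (ENNReal.ofReal (Real.pi ^ (n + 1))⁻¹ • ν) := by
    constructor
    rw [Measure.smul_apply, hν, smul_eq_mul, ← ENNReal.ofReal_mul (by positivity),
      inv_mul_cancel₀ hpi.ne', ENNReal.ofReal_one]
  refine ⟨ENNReal.ofReal (Real.pi ^ (n + 1))⁻¹ • ν, hμ, fun w hw s hs hs1 => ?_⟩
  have hw0 : w ≠ 0 := fun h => by simp [h] at hw
  -- With `c = (1 - s) / s` one has `1 + c = 1 / s`, so the cone has normalised measure at least `s
  -- ^ n`.
  have hcap := le_setLIntegral_exp_neg_sq_submodule _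
    (finrank_restrictScalars_span_singleton hw0) hER (c := (1 - s) / s)
    (div_nonneg (by linarith) hs.le)
  simp only [norm_orthogonalProjectionOnto_restrictScalars_span hw] at hcap
  have hset : {z : E | (1 - s) / s * (‖z‖ ^ 2 - ‖inner ℂ w z‖ ^ 2) ≤ ‖inner ℂ w z‖ ^ 2}
      = {z | (1 - s) * ‖z‖ ^ 2 ≤ ‖inner ℂ w z‖ ^ 2} := by
    ext z
    simp only [Set.mem_ofPred_eq]
    rw [div_mul_eq_mul_div, div_le_iff₀ hs]
    constructor <;> intro h <;> linarith
  have hms : MeasurableSet {z : E | (1 - s) * ‖z‖ ^ 2 ≤ ‖inner ℂ w z‖ ^ 2} :=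
    measurableSet_le (by fun_prop) (by fun_prop)
  rw [hset, ← withDensity_apply _ hms] at hcap
  have hval : Real.pi ^ (n + 1) / (1 + (1 - s) / s) ^ n = Real.pi ^ (n + 1) * s ^ n := by
    have : 1 + (1 - s) / s = s⁻¹ := by
      field_simp
      ring
    rw [this, inv_pow, div_inv_eq_mul]
  rw [hval] at hcap
  -- The origin, where no direction is defined, is a null set and may be removed.
  have hdiff : ν {z | z ≠ 0 ∧ (1 - s) * ‖z‖ ^ 2 ≤ ‖inner ℂ w z‖ ^ 2}
      = ν {z | (1 - s) * ‖z‖ ^ 2 ≤ ‖inner ℂ w z‖ ^ 2} := by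
    have h0 : ν {0} = 0 := withDensity_absolutelyContinuous _ _ (measure_singleton 0)
    rw [← measure_sdiff_null h0 (s := {z : E | (1 - s) * ‖z‖ ^ 2 ≤ ‖inner ℂ w z‖ ^ 2})]
    congr 1
    ext z
    simp [and_comm]
  rw [measureReal_def, ← ENNReal.ofReal_le_iff_le_toReal (measure_ne_top _ _), Measure.smul_apply,
    hdiff, smul_eq_mul]
  calc ENNReal.ofReal (s ^ n)
      = ENNReal.ofReal (Real.pi ^ (n + 1))⁻¹ * ENNReal.ofReal (Real.pi ^ (n + 1) * s ^ n) := by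
        rw [← ENNReal.ofReal_mul (by positivity), inv_mul_cancel_left₀ hpi.ne']
    _ ≤ _ := mul_le_mul_right hcap _

end ComplexGaussian

/-! ### Numerical estimates giving the constant 5. -/

section Numerics

theorem covering_density_le_of_lt_ten {n : ℕ} (h3 : 3 ≤ n) (h10 : n < 10) :
    (8 / 3) * n * Real.log (8 * n) + 2 ≤ 5 * (n + 1) * Real.log (n + 1) := by
  -- Three times the claim, exponentiated, so that small `n` becomes an integer comparison once `exp
  -- 6` is bounded by 404.
  have key : ((8 * n : ℕ) : ℝ) ^ (8 * n) * Real.exp 6 ≤ ((n + 1 : ℕ) : ℝ) ^ (15 * (n + 1)) := by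
    have he : Real.exp 6 ≤ 404 := by
      have h1 : Real.exp 6 = Real.exp 1 ^ 6 := by
        rw [← Real.exp_nat_mul]
        norm_num
      rw [h1]
      calc Real.exp 1 ^ 6 ≤ 2.7182818286 ^ 6 :=
            pow_le_pow_left₀ (Real.exp_pos _).le Real.exp_one_lt_d9.le 6
        _ ≤ 404 := by norm_num
    have hnat : (8 * n) ^ (8 * n) * 404 ≤ (n + 1) ^ (15 * (n + 1)) := by
      interval_cases n <;> norm_num
    calc _ ≤ ((8 * n : ℕ) : ℝ) ^ (8 * n) * 404 := mul_le_mul_of_nonneg_left he (by positivity)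
      _ ≤ _ := by exact_mod_cast hnat
  have hn : (0 : ℝ) < n := by exact_mod_cast (by omega : 0 < n)
  have hlog := Real.log_le_log (by positivity) key
  rw [Real.log_mul (by positivity) (Real.exp_pos _).ne', Real.log_pow, Real.log_pow,
    Real.log_exp] at hlog
  push_cast at hlog
  linarith

theorem covering_density_le {n : ℕ} (h3 : 3 ≤ n) :
    (8 / 3) * n * Real.log (8 * n) + 2 ≤ 5 * (n + 1) * Real.log (n + 1) := by
  rcases lt_or_ge n 10 with h10 | h10
  · exact covering_density_le_of_lt_ten h3 h10
  have hn : (10 : ℝ) ≤ n := by exact_mod_cast h10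
  have h1 : Real.log (8 * n) ≤ 3 * Real.log 2 + Real.log (n + 1) := by
    have : Real.log (8 * (n + 1 : ℝ)) = 3 * Real.log 2 + Real.log (n + 1) := by
      rw [Real.log_mul (by norm_num) (by positivity), show (8 : ℝ) = 2 ^ 3 by norm_num,
        Real.log_pow]
      norm_num
    rw [← this]
    exact Real.log_le_log (by positivity) (by linarith)
  -- The factor `24 / 7` makes `(7 / 3) n log (n + 1)` absorb `8 n log 2`; the leftover `5 log (n +
  -- 1)` exceeds 2.
  have h2 : 24 / 7 * Real.log 2 ≤ Real.log (n + 1) := by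
    have h := Real.log_le_log (by positivity)
      (show (2 : ℝ) ^ 24 ≤ (n + 1) ^ 7 from
        le_trans (by norm_num) (pow_le_pow_left₀ (by norm_num) (by linarith : (11 : ℝ) ≤ n + 1) 7))
    rw [Real.log_pow, Real.log_pow] at h
    push_cast at h
    linarith
  have h3 := Real.log_two_gt_d9
  have h4 := mul_le_mul_of_nonneg_left h1 (by positivity : (0 : ℝ) ≤ 8 / 3 * n)
  have h5 := mul_le_mul_of_nonneg_left h2 (by positivity : (0 : ℝ) ≤ 7 / 3 * n)
  linarith

theorem four_pow_le_covering_density {n : ℕ} (h1 : 1 ≤ n) (h2 : n < 3) :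
    (4 : ℝ) ^ n ≤ 5 * (n + 1) * Real.log (n + 1) := by
  have hl2 := Real.log_two_gt_d9
  -- For `n = 2` the claim is `16 ≤ 15 log 3`.
  have hl3 : 16 / 15 ≤ Real.log 3 := by
    rw [Real.le_log_iff_exp_le (by norm_num)]
    have h : Real.exp (16 / 15) ^ 15 ≤ 3 ^ 15 := by
      rw [← Real.exp_nat_mul]
      have h1 : Real.exp ((15 : ℕ) * (16 / 15)) = Real.exp 1 ^ 16 := by
        rw [← Real.exp_nat_mul]
        norm_num
      rw [h1]
      calc Real.exp 1 ^ 16 ≤ 2.7182818286 ^ 16 :=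
            pow_le_pow_left₀ (Real.exp_pos _).le Real.exp_one_lt_d9.le 16
        _ ≤ 3 ^ 15 := by norm_num
    exact le_of_pow_le_pow_left₀ (by norm_num) (by norm_num) h
  interval_cases n
  · norm_num
    linarith
  · norm_num
    linarith

/-- Parameters of the random covering with the resulting density. -/
theorem exists_covering_parameters {n : ℕ} (hn : 1 ≤ n) {δ : ℝ} (hδ : 0 < δ) (hδ1 : δ ≤ 1) :
    ∃ (η : ℝ) (N : ℕ), 0 < η ∧ η ≤ 1 / 2 ∧
      N + (1 - ((1 - η) ^ 2 * δ) ^ n) ^ N / (η ^ 2 * δ) ^ n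
        ≤ 5 * (n + 1) * Real.log (n + 1) * (1 / δ) ^ n := by
  have hδn : 0 < δ ^ n := by positivity
  have hδn1 : δ ^ n ≤ 1 := pow_le_one₀ hδ.le hδ1
  rcases lt_or_ge n 3 with h3 | h3
  -- With `N = 0` there are no greedy balls: a maximal packing at half the radius costs at most `(4
  -- / δ) ^ n`.
  · refine ⟨1 / 2, 0, by norm_num, le_rfl, ?_⟩
    have h := four_pow_le_covering_density hn h3
    have e : ((0 : ℕ) : ℝ) + (1 - ((1 - 1 / 2) ^ 2 * δ) ^ n) ^ 0 / ((1 / 2) ^ 2 * δ) ^ n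
        = 4 ^ n * (1 / δ) ^ n := by
      rw [← mul_pow, pow_zero, ← one_div_pow]
      norm_num
      ring
    rw [e]
    exact mul_le_mul_of_nonneg_right h (by positivity)
  have hn0 : (3 : ℝ) ≤ n := by exact_mod_cast h3
  set η : ℝ := 1 / (8 * n) with hη
  have hη0 : 0 < η := by positivity
  have hη1 : η ≤ 1 / 2 := by
    rw [hη, div_le_div_iff₀ (by positivity) (by norm_num)]
    linarith
  -- Bernoulli's inequality with `η = 1 / (8 n)` gives `(1 - η) ^ (2 n) ≥ 3 / 4`. `T` solves `exp
  -- (-(3 / 4) T) = η ^ (2 n)`, so the uncovered measure offsets the small packing caps and the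
  -- packing costs at most `1 / δ ^ n`.
  set T : ℝ := (8 / 3) * n * Real.log (8 * n) with hT
  have hlog : 0 ≤ Real.log (8 * n) := Real.log_nonneg (by linarith)
  have hT0 : 0 ≤ T := by positivity
  have ha : 3 / 4 ≤ ((1 - η) ^ 2) ^ n := by
    rw [← pow_mul]
    have hb := one_add_mul_le_pow (a := -η) (by linarith) (2 * n)
    have e : 1 + ((2 * n : ℕ) : ℝ) * -η = 3 / 4 := by
      rw [hη]
      push_cast
      field_simp
      norm_num
    rw [e] at hb
    exact hb.trans (le_of_eq (by ring))
  set N : ℕ := ⌈T / δ ^ n⌉₊ with hN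
  refine ⟨η, N, hη0, hη1, ?_⟩
  have hN1 : (N : ℝ) ≤ T / δ ^ n + 1 := (Nat.ceil_lt_add_one (by positivity)).le
  have hN2 : T / δ ^ n ≤ N := Nat.le_ceil _
  have hv1 : ((1 - η) ^ 2 * δ) ^ n ≤ 1 := by
    refine pow_le_one₀ (by positivity) (mul_le_one₀ (pow_le_one₀ (by linarith) (by linarith))
      hδ.le hδ1)
  have hdecay : (1 - ((1 - η) ^ 2 * δ) ^ n) ^ N ≤ (η ^ 2) ^ n := by
    have h1 : 1 - ((1 - η) ^ 2 * δ) ^ n ≤ Real.exp (-(3 / 4 * δ ^ n)) := by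
      have h2 := Real.add_one_le_exp (-(3 / 4 * δ ^ n))
      have h3 : 3 / 4 * δ ^ n ≤ ((1 - η) ^ 2 * δ) ^ n := by
        rw [mul_pow]
        exact mul_le_mul_of_nonneg_right ha hδn.le
      linarith
    calc _ ≤ Real.exp (-(3 / 4 * δ ^ n)) ^ N := pow_le_pow_left₀ (by linarith) h1 N
      _ = Real.exp (-(3 / 4) * (N * δ ^ n)) := by
          rw [← Real.exp_nat_mul]
          congr 1
          ring
      _ ≤ Real.exp (-(3 / 4) * T) := by
          refine Real.exp_le_exp.2 ?_
          rw [div_le_iff₀ hδn] at hN2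
          linarith
      _ = (η ^ 2) ^ n := by
          have h8 : (0 : ℝ) < 8 * n := by positivity
          have e : -(3 / 4) * T = -((2 * n : ℕ) * Real.log (8 * n)) := by
            rw [hT]
            push_cast
            ring
          rw [← pow_mul, hη, one_div, inv_pow, e, Real.exp_neg, Real.exp_nat_mul,
            Real.exp_log h8]
  have hfrac : (1 - ((1 - η) ^ 2 * δ) ^ n) ^ N / (η ^ 2 * δ) ^ n ≤ 1 / δ ^ n := by
    rw [div_le_div_iff₀ (by positivity) hδn, mul_pow (η ^ 2)]
    have := mul_le_mul_of_nonneg_right hdecay hδn.le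
    linarith
  have hone : 1 ≤ 1 / δ ^ n := by
    rw [le_div_iff₀ hδn]
    linarith
  calc _ ≤ T / δ ^ n + 1 / δ ^ n + 1 / δ ^ n := by linarith
    _ = (T + 2) * (1 / δ) ^ n := by
        rw [one_div_pow]
        ring
    _ ≤ _ := mul_le_mul_of_nonneg_right (covering_density_le h3) (by positivity)

end Numerics

/-! ### From coverings in Hilbert–Schmidt distance to nets of pure states. -/

section Embedding

open MeasureTheory

variable {n : Type*}

/-- The entries of `|v⟩⟨v|` as a vector. -/
noncomputable def ketbraVec (v : EuclideanSpace ℂ n) : EuclideanSpace ℂ (n × n) :=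
  WithLp.toLp 2 fun p => v p.1 * star (v p.2)

theorem continuous_ketbraVec : Continuous (ketbraVec : EuclideanSpace ℂ n → _) := by
  unfold ketbraVec
  fun_prop

variable [Fintype n]

theorem inner_ketbraVec (u v : EuclideanSpace ℂ n) :
    inner ℂ (ketbraVec u) (ketbraVec v) = ((‖inner ℂ u v‖ ^ 2 : ℝ) : ℂ) := by
  rw [← trace_ketbra_mul_ketbra, PiLp.inner_apply, Fintype.sum_prod_type_right]
  simp only [Matrix.trace, Matrix.diag_apply, Matrix.mul_apply, ketbra, Matrix.of_apply, ketbraVec,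
    RCLike.inner_apply, map_mul, starRingEnd_apply, star_star]
  exact Finset.sum_congr rfl fun a _ => Finset.sum_congr rfl fun c _ => by ring

/-- On unit vectors this distance is `√2` times the trace distance of the pure states, so the
abstract covering lemma applies with radii scaled by `√2`. -/
theorem dist_ketbraVec {u v : EuclideanSpace ℂ n} (hu : ‖u‖ = 1) (hv : ‖v‖ = 1) :
    dist (ketbraVec u) (ketbraVec v) ^ 2 = 2 * (1 - ‖inner ℂ u v‖ ^ 2) := by
  have hnorm : ∀ w : EuclideanSpace ℂ n, ‖w‖ = 1 → ‖ketbraVec w‖ ^ 2 = 1 := by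
    intro w hw
    have h := inner_self_eq_norm_sq_to_K (𝕜 := ℂ) (ketbraVec w)
    rw [inner_ketbraVec, inner_self_eq_norm_sq_to_K, hw] at h
    refine Complex.ofReal_injective ?_
    simpa using h.symm
  rw [dist_eq_norm, norm_sub_sq (𝕜 := ℂ), hnorm u hu, hnorm v hv, inner_ketbraVec]
  have e : RCLike.re ((‖inner ℂ u v‖ ^ 2 : ℝ) : ℂ) = ‖inner ℂ u v‖ ^ 2 := Complex.ofReal_re _
  rw [e]
  ring

/-- The unit vector along `z`, with the value `w` at zero. -/
noncomputable def normalizeOr {E : Type*} [NormedAddCommGroup E] [InnerProductSpace ℂ E]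
    (w z : E) : E :=
  open Classical in if z = 0 then w else ((‖z‖⁻¹ : ℝ) : ℂ) • z

theorem norm_normalizeOr {E : Type*} [NormedAddCommGroup E] [InnerProductSpace ℂ E]
    {w : E} (hw : ‖w‖ = 1) (z : E) : ‖normalizeOr w z‖ = 1 := by
  unfold normalizeOr
  split_ifs with h
  · exact hw
  · rw [norm_smul, Complex.norm_real, norm_inv, norm_norm, inv_mul_cancel₀ (norm_ne_zero_iff.2 h)]

theorem normalizeOr_of_norm_eq_one {E : Type*} [NormedAddCommGroup E] [InnerProductSpace ℂ E]
    (w : E) {z : E} (hz : ‖z‖ = 1) : normalizeOr w z = z := by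
  have h : z ≠ 0 := fun h => by simp [h] at hz
  simp [normalizeOr, h, hz]

theorem measurable_normalizeOr {E : Type*} [NormedAddCommGroup E] [InnerProductSpace ℂ E]
    [MeasurableSpace E] [BorelSpace E] [SecondCountableTopology E] (w : E) :
    Measurable (normalizeOr w) := by
  classical
  have hc : Measurable fun z : E => ((‖z‖⁻¹ : ℝ) : ℂ) • z :=
    (Complex.measurable_ofReal.comp measurable_norm.inv).smul measurable_id
  unfold normalizeOr
  exact Measurable.ite (measurableSet_singleton (0 : E)) measurable_const hc

/-- The cap condition is homogeneous in `z`, so away from the origin it passes to the normalised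
vector, where it says that the squared trace distance is at most `r ^ 2`. -/
theorem pow_le_measureReal_dist_le {d k : ℕ} {μ : Measure (EuclideanSpace ℂ (Fin d))}
    [IsProbabilityMeasure μ]
    (hμ : ∀ w : EuclideanSpace ℂ (Fin d), ‖w‖ = 1 → ∀ s : ℝ, 0 < s → s ≤ 1 →
      s ^ k ≤ μ.real {z | z ≠ 0 ∧ (1 - s) * ‖z‖ ^ 2 ≤ ‖inner ℂ w z‖ ^ 2})
    {w : EuclideanSpace ℂ (Fin d)} (hw : ‖w‖ = 1) {r : ℝ} (hr : 0 < r) (hr1 : r ≤ 1)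
    (x : EuclideanSpace ℂ (Fin d)) :
    (r ^ 2) ^ k ≤ μ.real {y | dist (ketbraVec (normalizeOr w x)) (ketbraVec (normalizeOr w y))
      ≤ √2 * r} := by
  refine (hμ _ (norm_normalizeOr hw x) (r ^ 2) (by positivity) (pow_le_one₀ hr.le hr1)).trans
    (measureReal_mono ?_)
  rintro z ⟨hz, hle⟩
  refine (sq_le_sq₀ dist_nonneg (by positivity)).1 ?_
  rw [dist_ketbraVec (norm_normalizeOr hw x) (norm_normalizeOr hw z), mul_pow,
    Real.sq_sqrt zero_le_two]
  have hz0 : 0 < ‖z‖ := norm_pos_iff.2 hz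
  have e : ‖inner ℂ (normalizeOr w x) (normalizeOr w z)‖ ^ 2
      = ‖inner ℂ (normalizeOr w x) z‖ ^ 2 / ‖z‖ ^ 2 := by
    have : normalizeOr w z = ((‖z‖⁻¹ : ℝ) : ℂ) • z := by simp [normalizeOr, hz]
    rw [this, inner_smul_right, norm_mul, Complex.norm_real, norm_inv, norm_norm, mul_pow, inv_pow]
    ring
  have h2 : 1 - r ^ 2 ≤ ‖inner ℂ (normalizeOr w x) z‖ ^ 2 / ‖z‖ ^ 2 := by
    rwa [le_div_iff₀ (by positivity)]
  rw [e]
  linarith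

/-- A net of the pure states of size at most `5 d ln d (1/δ)^(d-1)`. -/
theorem exists_isPureNet_card_le {k : ℕ} (hk : 1 ≤ k) {δ : ℝ} (hδ : 0 < δ) (hδ1 : δ ≤ 1) :
    ∃ I : Finset (Matrix (Fin (k + 1)) (Fin (k + 1)) ℂ), IsPureNet (√δ) I ∧
      (I.card : ℝ) ≤ 5 * (k + 1) * Real.log (k + 1) * (1 / δ) ^ k := by
  classical
  obtain ⟨μ, hμP, hμ⟩ := exists_isProbabilityMeasure_cap
    (E := EuclideanSpace ℂ (Fin (k + 1))) (n := k) (by simp)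
  obtain ⟨η, N, hη0, hη1, hN⟩ := exists_covering_parameters hk hδ hδ1
  set w : EuclideanSpace ℂ (Fin (k + 1)) := EuclideanSpace.single 0 1 with hwdef
  have hw : ‖w‖ = 1 := by simp [hwdef]
  have hs0 : 0 < √δ := Real.sqrt_pos.2 hδ
  have hs1 : √δ ≤ 1 := Real.sqrt_le_one.2 hδ1
  have hsq : √δ ^ 2 = δ := Real.sq_sqrt hδ.le
  have hball : ∀ {c : ℝ}, 0 < c → c ≤ 1 → ∀ x, (c ^ 2 * δ) ^ k ≤
      μ.real {y | dist (ketbraVec (normalizeOr w x)) (ketbraVec (normalizeOr w y))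
        ≤ √2 * (c * √δ)} := by
    intro c hc hc1 x
    have h := pow_le_measureReal_dist_le hμ hw (r := c * √δ) (by positivity)
      (mul_le_one₀ hc1 hs0.le hs1) x
    rwa [mul_pow, hsq] at h
  -- The two radii are the fractions `1 - η` and `η` of `√2 * √δ`, so their sum is exactly the net
  -- radius.
  obtain ⟨J, hJ, hcov⟩ := exists_finset_cover μ
    (continuous_ketbraVec.measurable.comp (measurable_normalizeOr w))
    (r := √2 * ((1 - η) * √δ)) (ε := √2 * (η * √δ)) (by positivity)
    (mul_le_mul_of_nonneg_left (mul_le_mul_of_nonneg_right (by linarith) hs0.le) (by positivity))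
    (by positivity)
    (pow_le_one₀ (by positivity) (mul_le_one₀ (pow_le_one₀ (by linarith) (by linarith)) hδ.le hδ1))
    (hball (c := 1 - η) (by linarith) (by linarith)) (w := (η ^ 2 * δ) ^ k) (by positivity)
    (hball hη0 (by linarith)) N
  refine ⟨J.image fun x => ketbra (normalizeOr w x), ⟨?_, ?_⟩, ?_⟩
  · intro φ hφ
    obtain ⟨x, -, rfl⟩ := Finset.mem_image.1 hφ
    exact ketbra_mem_pureStates (norm_normalizeOr hw x)
  · intro φ hφ
    obtain ⟨v, hv, rfl⟩ := exists_eq_ketbra_of_mem_pureStates hφ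
    obtain ⟨x, hxJ, hx⟩ := hcov v
    refine ⟨_, Finset.mem_image_of_mem _ hxJ, ?_⟩
    rw [trNorm_ketbra_sub_ketbra (norm_normalizeOr hw x) hv]
    refine Real.sqrt_le_sqrt ?_
    simp only [Function.comp_apply, normalizeOr_of_norm_eq_one w hv] at hx
    have h := pow_le_pow_left₀ dist_nonneg hx 2
    have e : √2 * ((1 - η) * √δ) + √2 * (η * √δ) = √2 * √δ := by ring
    rw [e, dist_ketbraVec (norm_normalizeOr hw x) hv, mul_pow, hsq, Real.sq_sqrt zero_le_two] at h
    linarith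
  · refine le_trans ?_ (hJ.trans hN)
    exact_mod_cast Finset.card_image_le

end Embedding

/-! ### Minimum nets and the main theorem. -/

theorem exists_isMinPureNet {d : ℕ} {ε : ℝ}
    (h : ∃ I : Finset (Matrix (Fin d) (Fin d) ℂ), IsPureNet ε I) :
    ∃ I : Finset (Matrix (Fin d) (Fin d) ℂ), IsMinPureNet ε I := by
  obtain ⟨I, hI, hmin⟩ := exists_minimalFor_of_wellFoundedLT
    (fun I : Finset (Matrix (Fin d) (Fin d) ℂ) => IsPureNet ε I) (fun I => I.card) h
  refine ⟨I, hI, fun J hJ => ?_⟩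
  rcases le_total I.card J.card with hle | hle
  · exact hle
  · exact hmin hJ hle

theorem logb_card_mul_le {k : ℕ} (hk : 1 ≤ k) {δ : ℝ} (hδ : 0 < δ)
    {I : Finset (Matrix (Fin (k + 1)) (Fin (k + 1)) ℂ)} (hI : IsPureNet (√δ) I)
    (hc : (I.card : ℝ) ≤ 5 * (k + 1) * Real.log (k + 1) * (1 / δ) ^ k) :
    Real.logb 2 ((I.card * (k + 1) : ℕ) : ℝ) ≤
      (((k + 1 : ℕ) : ℝ) - 1) * Real.logb 2 (1 / δ)
        + Real.logb 2 (5 * (k + 1 : ℕ) * Real.log (k + 1 : ℕ)) + Real.logb 2 (k + 1 : ℕ) := by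
  -- A net is nonempty because pure states exist; the monotonicity of the logarithm needs this
  -- positive cardinality.
  obtain ⟨φ, hφ, -⟩ := hI.2 _ (ketbra_mem_pureStates
    (v := EuclideanSpace.single (0 : Fin (k + 1)) (1 : ℂ)) (by simp))
  have hcard : (0 : ℝ) < I.card := by exact_mod_cast Finset.card_pos.2 ⟨φ, hφ⟩
  have hk0 : (1 : ℝ) ≤ k := by exact_mod_cast hk
  have hlog : 0 < Real.log (k + 1) := Real.log_pos (by linarith)
  push_cast
  have h := Real.logb_le_logb_of_le one_lt_two (mul_pos hcard (by positivity : (0 : ℝ) < k + 1))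
    (mul_le_mul_of_nonneg_right hc (by positivity : (0 : ℝ) ≤ k + 1))
  rw [Real.logb_mul (x := 5 * (k + 1) * Real.log (k + 1) * (1 / δ) ^ k) (by positivity)
      (by positivity),
    Real.logb_mul (x := 5 * (k + 1) * Real.log (k + 1)) (by positivity) (by positivity),
    Real.logb_pow] at h
  linarith

theorem mainTheorem2 (d : ℕ) :
    (∀ δ : ℝ, 0 ≤ δ → ∀ I : Finset (Matrix (Fin d) (Fin d) ℂ), IsPureNet (√δ) I →
      ∀ e : OrthonormalBasis I ℂ (EuclideanSpace ℂ (Fin I.card)),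
        IsDisentangler 0 δ (netChannel I e) ∧ IsStrongDisentangler 0 δ (netChannel I e)) ∧
    (2 ≤ d → ∀ δ : ℝ, 0 < δ → δ ≤ 1 →
      (∃ I : Finset (Matrix (Fin d) (Fin d) ℂ), IsMinPureNet (√δ) I) ∧
      ∀ I : Finset (Matrix (Fin d) (Fin d) ℂ), IsMinPureNet (√δ) I →
        Real.logb 2 ((I.card * d : ℕ) : ℝ) ≤
          ((d : ℝ) - 1) * Real.logb 2 (1 / δ) + Real.logb 2 (5 * d * Real.log d)
            + Real.logb 2 d) := by
  refine ⟨fun δ hδ I hI e => ⟨isDisentangler_netChannel e hδ hI,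
    isStrongDisentangler_netChannel e hδ hI⟩, fun hd δ hδ hδ1 => ?_⟩
  obtain ⟨k, rfl⟩ : ∃ k, d = k + 1 := ⟨d - 1, by omega⟩
  have hk : 1 ≤ k := by omega
  obtain ⟨J, hJ, hJc⟩ := exists_isPureNet_card_le hk hδ hδ1
  refine ⟨exists_isMinPureNet ⟨J, hJ⟩, fun I hI => logb_card_mul_le hk hδ hI.1 (le_trans ?_ hJc)⟩
  exact_mod_cast hI.2 J hJ
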